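/- Conventions. A group $G$ satisfies the \emph{power alternative} if for all $g,h\in G$ there is an integer $n\ge 1$ such that either $g^n$ and $h^n$ commute or $\langle g^n,h^n\rangle$ is free of rank $2$. A \emph{geodesic} in a metric space is (the image of) an isometric embedding of an interval of $\mathbb{R}$. A \emph{real tree} is a metric space $T$ in which any two points $x,y$ are joined by a unique geodesic segment $[x,y]$, and in which $[x,y]\cap[y,z]=\{y\}$ implies $[x,y]\cup[y,z]=[x,z]$. Its boundary $\partial T$ is the set of geodesic rays $[0,\infty)\to T$ up to bounded distance. An action of $G$ on a real tree $T$ by isometries has the \emph{stabilisation property} if for every sequence $(\gamma_n)_{n\ge1}$ of geodesics of $T$ that is monotonic for inclusion ($\gamma_n\subseteq\gamma_{n+1}$ for all $n$, or $\gamma_{n+1}\subseteq\gamma_n$ for all $n$) and whose lengths $\ell(\gamma_n)\in[0,+\infty]$ tend to $+\infty$, the pointwise stabilisers $H_n$ of $\gamma_n$ satisfy $H_n=H_{n+1}$ for all sufficiently large $n$. A simplicial tree is regarded as a real tree through its geometric realisation, with the path metric in which every edge has length $1$. Theorem. Let $G$ be a group. (1) Let $G$ act by graph automorphisms on a simplicial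 tree $T$ such that the action has the stabilisation property. If the stabiliser of every vertex of $T$ and of every point of $\partial T$ satisfies the power alternative, then $G$ satisfies the power alternative. (2) Let $G$ act by isometries on a non-empty real tree $T$ such that the action has the stabilisation property. If the stabiliser of every point of $T\cup\partial T$ satisfies the power alternative, then $G$ satisfies the power alternative. (3) Let $G$ act by isometries on a non-empty real tree $T$ such that the action has the stabilisation property. Then for all $g,h\in G$ there is an integer $n\ge 1$ such that either $\langle g^n,h^n\rangle$ is free of rank $2$, or $g^n$ and $h^n$ both fix a common point of $T\cup\partial T$. -/

import Mathlib

open Filter Topology MeasureTheory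
open scoped NNReal ENNReal

/-! ### The power alternative -/

/-- A group satisfies the power alternative if any two elements have a common positive power `n`
such that `g ^ n` and `h ^ n` either commute or generate a free group of rank two. -/
def PowerAlternative (G : Type*) [Group G] : Prop :=
  ∀ g h : G, ∃ n : ℕ, 1 ≤ n ∧
    (Commute (g ^ n) (h ^ n) ∨
      Nonempty (Subgroup.closure ({g ^ n, h ^ n} : Set G) ≃* FreeGroup (Fin 2)))

/-! ### Geodesics and real trees -/

section RealTrees

variable {T : Type*} [MetricSpace T]

/-- `γ` restricted to `I` is a geodesic: `I` is an interval of the real line (open, closed,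
half-open, bounded or not) and `γ` is an isometric embedding of `I`. -/
def IsGeodesicOn (γ : ℝ → T) (I : Set ℝ) : Prop :=
  I.OrdConnected ∧ ∀ s ∈ I, ∀ t ∈ I, dist (γ s) (γ t) = |s - t|

/-- The set `S` is (the image of) a geodesic segment from `x` to `y`. -/
def IsGeodesicSegment (x y : T) (S : Set T) : Prop :=
  ∃ (a b : ℝ) (γ : ℝ → T), a ≤ b ∧ IsGeodesicOn γ (Set.Icc a b) ∧ γ a = x ∧ γ b = y ∧
    γ '' Set.Icc a b = S

/-- Real trees: any two points are joined by a unique geodesic segment, and two segments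
`[x, y]` and `[y, z]` that meet only in `y` concatenate to the segment `[x, z]`. -/
structure IsRealTree (T : Type*) [MetricSpace T] : Prop where
  existsUnique_segment : ∀ x y : T, ∃! S : Set T, IsGeodesicSegment x y S
  segment_union : ∀ (x y z : T) (S S' : Set T), IsGeodesicSegment x y S →
    IsGeodesicSegment y z S' → S ∩ S' = {y} → IsGeodesicSegment x z (S ∪ S')

/-! ### The boundary -/

/-- Geodesic rays, parametrised by `[0, ∞)`. -/
def GeodesicRay (T : Type*) [MetricSpace T] : Type _ := {r : ℝ≥0 → T // Isometry r}

/-- Two geodesic rays are asymptotic if they stay at bounded distance from each other. -/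
def GeodesicRay.asymptotic (T : Type*) [MetricSpace T] : Setoid (GeodesicRay T) where
  r r₁ r₂ := ∃ C : ℝ, ∀ t : ℝ≥0, dist (r₁.1 t) (r₂.1 t) ≤ C
  iseqv :=
    { refl := fun r => ⟨0, fun t => by simp⟩
      symm := fun {r s} ⟨C, h⟩ => ⟨C, fun t => by rw [dist_comm]; exact h t⟩
      trans := fun {r s u} ⟨C, h⟩ ⟨D, k⟩ =>
        ⟨C + D, fun t => (dist_triangle _ (s.1 t) _).trans (add_le_add (h t) (k t))⟩ }

/-- The boundary `∂T`: geodesic rays up to bounded distance. -/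
def TreeBoundary (T : Type*) [MetricSpace T] : Type _ := Quotient (GeodesicRay.asymptotic T)

/-- The image of a geodesic ray under an isometry. -/
def GeodesicRay.map (f : T ≃ᵢ T) (r : GeodesicRay T) : GeodesicRay T :=
  ⟨fun t => f (r.1 t), f.isometry.comp r.2⟩

/-- The map induced on the boundary by an isometry. -/
def TreeBoundary.map (f : T ≃ᵢ T) : TreeBoundary T → TreeBoundary T :=
  Quotient.map' (s₁ := GeodesicRay.asymptotic T) (s₂ := GeodesicRay.asymptotic T)
    (GeodesicRay.map f) (fun _ _ ⟨C, h⟩ => ⟨C, fun t => (f.dist_eq _ _).trans_le (h t)⟩)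

theorem TreeBoundary.map_one (ξ : TreeBoundary T) : TreeBoundary.map (1 : T ≃ᵢ T) ξ = ξ := by
  induction ξ using Quotient.inductionOn'
  rfl

theorem TreeBoundary.map_mul (f g : T ≃ᵢ T) (ξ : TreeBoundary T) :
    TreeBoundary.map (f * g) ξ = TreeBoundary.map f (TreeBoundary.map g ξ) := by
  induction ξ using Quotient.inductionOn'
  rfl

/-! ### Isometric actions

An action of a group `G` on `T` by isometries is a homomorphism `G →* (T ≃ᵢ T)`. -/

variable {G : Type*} [Group G]

/-- The stabiliser in `G` of a point of `T`. -/
def pointStabiliser (ρ : G →* (T ≃ᵢ T)) (x : T) : Subgroup G where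
  carrier := {g | ρ g x = x}
  one_mem' := by simp
  mul_mem' := fun {g h} hg hh => by
    change ρ g x = x at hg
    change ρ h x = x at hh
    change ρ (g * h) x = x
    rw [_root_.map_mul, IsometryEquiv.mul_apply, hh, hg]
  inv_mem' := fun {g} hg => by
    change ρ g x = x at hg
    change ρ g⁻¹ x = x
    conv_lhs => rw [← hg]
    rw [_root_.map_inv, IsometryEquiv.inv_apply_self]

/-- The stabiliser in `G` of a boundary point of `T`. -/
def boundaryStabiliser (ρ : G →* (T ≃ᵢ T)) (ξ : TreeBoundary T) : Subgroup G where
  carrier := {g | TreeBoundary.map (ρ g) ξ = ξ}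
  one_mem' := by
    change TreeBoundary.map (ρ 1) ξ = ξ
    rw [_root_.map_one, TreeBoundary.map_one]
  mul_mem' := fun {g h} hg hh => by
    change TreeBoundary.map (ρ g) ξ = ξ at hg
    change TreeBoundary.map (ρ h) ξ = ξ at hh
    change TreeBoundary.map (ρ (g * h)) ξ = ξ
    rw [_root_.map_mul, TreeBoundary.map_mul, hh, hg]
  inv_mem' := fun {g} hg => by
    change TreeBoundary.map (ρ g) ξ = ξ at hg
    change TreeBoundary.map (ρ g⁻¹) ξ = ξ
    conv_lhs => rw [← hg]
    rw [← TreeBoundary.map_mul, ← _root_.map_mul, inv_mul_cancel, _root_.map_one,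
      TreeBoundary.map_one]

/-- The pointwise stabiliser in `G` of a subset of `T`. -/
def pointwiseStabiliser (ρ : G →* (T ≃ᵢ T)) (S : Set T) : Subgroup G :=
  ⨅ x ∈ S, pointStabiliser ρ x

/-- The stabilisation property: for every sequence of geodesics that is monotonic for inclusion
and whose lengths tend to infinity, the pointwise stabilisers are eventually constant. The
length of the geodesic `γ n` on the interval `I n` is the length of `I n`, possibly infinite. -/
def HasStabilisation (ρ : G →* (T ≃ᵢ T)) : Prop :=
  ∀ (γ : ℕ → ℝ → T) (I : ℕ → Set ℝ), (∀ n, IsGeodesicOn (γ n) (I n)) →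
    ((∀ n, γ n '' I n ⊆ γ (n + 1) '' I (n + 1)) ∨
      (∀ n, γ (n + 1) '' I (n + 1) ⊆ γ n '' I n)) →
    Tendsto (fun n => volume (I n)) atTop (𝓝 (∞ : ℝ≥0∞)) →
    ∃ N : ℕ, ∀ n, N ≤ n →
      pointwiseStabiliser ρ (γ n '' I n) = pointwiseStabiliser ρ (γ (n + 1) '' I (n + 1))

end RealTrees

/-! ### Simplicial trees as metric spaces

The geometric realisation of a connected graph, with the path metric in which every edge is
isometric to `[0, 1]`. -/

section Realisation

variable {V : Type*}

/-- `{u, v}` is a closed cell of the graph: a vertex (`u = v`) or an edge. -/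
def SimpleGraph.IsCell (Γ : SimpleGraph V) (u v : V) : Prop := u = v ∨ Γ.Adj u v

/-- The points of the geometric realisation of a connected graph, by barycentric coordinates. -/
@[ext]
structure Realisation (Γ : SimpleGraph V) (hΓ : Γ.Connected) where
  coord : V →₀ ℝ
  nonneg : ∀ v, 0 ≤ coord v
  sum_eq_one : (coord.sum fun _ a => a) = 1
  supported : ∃ u v, Γ.IsCell u v ∧ (coord.support : Set V) ⊆ {u, v}

namespace Realisation

variable {Γ : SimpleGraph V} {hΓ : Γ.Connected}

/-- `x` lies on the closed cell with vertices `u`, `v`. -/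
def OnCell (x : Realisation Γ hΓ) (u v : V) : Prop := (x.coord.support : Set V) ⊆ {u, v}

/-- `PathLength x y L`: there is a piecewise linear path from `x` to `y`, each piece of which
runs inside one closed cell, of total length `L`, every edge having length one. -/
inductive PathLength : Realisation Γ hΓ → Realisation Γ hΓ → ℝ → Prop
  | nil (x : Realisation Γ hΓ) : PathLength x x 0
  | cons {x y z : Realisation Γ hΓ} {L : ℝ} (u v : V) (huv : Γ.IsCell u v)
      (hx : x.OnCell u v) (hy : y.OnCell u v) (p : PathLength y z L) :
      PathLength x z (|x.coord u - y.coord u| + L)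

theorem OnCell.coord_eq_zero {x : Realisation Γ hΓ} {u v w : V} (h : x.OnCell u v)
    (hu : w ≠ u) (hv : w ≠ v) : x.coord w = 0 := by
  by_contra hne
  have := h (Finset.mem_coe.2 (Finsupp.mem_support_iff.2 hne))
  simp [hu, hv] at this

theorem OnCell.sum {x : Realisation Γ hΓ} {u v : V} (h : x.OnCell u v) (huv : u ≠ v) :
    x.coord u + x.coord v = 1 := by
  classical
  have hs : x.coord.support ⊆ ({u, v} : Finset V) := fun w hw => by
    have := h (Finset.mem_coe.2 hw)
    simpa using this
  have := x.sum_eq_one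
  rwa [Finsupp.sum_of_support_subset _ hs _ (by simp), Finset.sum_pair huv] at this

theorem OnCell.eq_one {x : Realisation Γ hΓ} {u : V} (h : x.OnCell u u) : x.coord u = 1 := by
  classical
  have hs : x.coord.support ⊆ ({u} : Finset V) := fun w hw => by
    have := h (Finset.mem_coe.2 hw)
    simpa using this
  have := x.sum_eq_one
  rwa [Finsupp.sum_of_support_subset _ hs _ (by simp), Finset.sum_singleton] at this

theorem OnCell.symm {x : Realisation Γ hΓ} {u v : V} (h : x.OnCell u v) : x.OnCell v u := by
  intro w hw
  have := h hw
  simp only [Set.mem_insert_iff, Set.mem_singleton_iff] at this ⊢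
  exact this.symm

theorem OnCell.abs_le {x y : Realisation Γ hΓ} {u v : V} (hx : x.OnCell u v)
    (hy : y.OnCell u v) (w : V) :
    |x.coord w - y.coord w| ≤ |x.coord u - y.coord u| := by
  by_cases hu : w = u
  · rw [hu]
  · by_cases hv : w = v
    · subst hv
      have h1 := hx.sum (Ne.symm hu)
      have h2 := hy.sum (Ne.symm hu)
      have : x.coord w - y.coord w = -(x.coord u - y.coord u) := by linarith
      rw [this, abs_neg]
    · rw [hx.coord_eq_zero hu hv, hy.coord_eq_zero hu hv]
      simp

theorem PathLength.abs_le {x y : Realisation Γ hΓ} {L : ℝ} (p : PathLength x y L) (w : V) :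
    |x.coord w - y.coord w| ≤ L := by
  induction p with
  | nil x => simp
  | cons u v huv hx hy p ih =>
    exact (abs_sub_le _ _ _).trans (add_le_add (hx.abs_le hy w) ih)

theorem PathLength.nonneg {x y : Realisation Γ hΓ} {L : ℝ} (p : PathLength x y L) : 0 ≤ L := by
  induction p with
  | nil x => exact le_rfl
  | cons u v huv hx hy p ih => exact add_nonneg (abs_nonneg _) ih

theorem PathLength.trans {x y z : Realisation Γ hΓ} {L M : ℝ} (p : PathLength x y L)
    (q : PathLength y z M) : PathLength x z (L + M) := by
  induction p with
  | nil x => simpa using q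
  | cons u v huv hx hy p ih => rw [add_assoc]; exact .cons u v huv hx hy (ih q)

theorem PathLength.symm {x y : Realisation Γ hΓ} {L : ℝ} (p : PathLength x y L) :
    PathLength y x L := by
  induction p with
  | nil x => exact .nil x
  | @cons x y z L u v huv hx hy p ih =>
    have := ih.trans (.cons u v huv hy hx (.nil x))
    rwa [add_zero, abs_sub_comm, add_comm] at this

/-- A vertex of the graph, as a point of the realisation. -/
noncomputable def vertex (v : V) : Realisation Γ hΓ where
  coord := Finsupp.single v 1
  nonneg := fun w => by
    classical
    rw [Finsupp.single_apply]; split_ifs <;> norm_num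
  sum_eq_one := by simp
  supported := ⟨v, v, Or.inl rfl, fun w hw => by
    have := Finsupp.support_single_subset (Finset.mem_coe.1 hw)
    simpa using this⟩

theorem vertex_onCell_left (u v : V) : (vertex u : Realisation Γ hΓ).OnCell u v := fun w hw => by
  have := Finsupp.support_single_subset (Finset.mem_coe.1 hw)
  exact Or.inl (by simpa using this)

theorem exists_pathLength_vertex (u v : V) :
    ∃ L, PathLength (vertex u : Realisation Γ hΓ) (vertex v) L := by
  obtain ⟨p⟩ := hΓ.preconnected u v
  induction p with
  | nil => exact ⟨0, .nil _⟩
  | @cons a b c h p ih =>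
    obtain ⟨L, q⟩ := ih
    exact ⟨_, .cons a b (Or.inr h) (vertex_onCell_left a b) (vertex_onCell_left b a).symm q⟩

theorem exists_pathLength (x y : Realisation Γ hΓ) : ∃ L, PathLength x y L := by
  obtain ⟨a, b, hab, hx⟩ := x.supported
  obtain ⟨c, d, hcd, hy⟩ := y.supported
  obtain ⟨L, p⟩ := exists_pathLength_vertex (hΓ := hΓ) a c
  exact ⟨_, .cons a b hab hx (vertex_onCell_left a b)
    (p.trans (.cons c d hcd (vertex_onCell_left c d) hy (.nil y)))⟩

/-- The path metric on the geometric realisation of a connected graph. -/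
noncomputable instance : MetricSpace (Realisation Γ hΓ) where
  dist x y := sInf {L | PathLength x y L}
  dist_self x := le_antisymm (csInf_le ⟨0, fun _ p => p.nonneg⟩ (.nil x))
    (le_csInf ⟨0, .nil x⟩ fun _ p => p.nonneg)
  dist_comm x y := by
    congr 1
    ext L
    exact ⟨fun p => p.symm, fun p => p.symm⟩
  dist_triangle x y z := by
    refine le_of_forall_pos_lt_add fun ε hε => ?_
    obtain ⟨L, hL, hL'⟩ := exists_lt_of_csInf_lt (exists_pathLength x y)
      (lt_add_of_pos_right (sInf {L | PathLength x y L}) (half_pos hε))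
    obtain ⟨M, hM, hM'⟩ := exists_lt_of_csInf_lt (exists_pathLength y z)
      (lt_add_of_pos_right (sInf {L | PathLength y z L}) (half_pos hε))
    have := csInf_le (s := {L | PathLength x z L}) ⟨0, fun _ p => p.nonneg⟩
      (PathLength.trans hL hM)
    linarith
  eq_of_dist_eq_zero {x y} h := by
    change sInf {L | PathLength x y L} = 0 at h
    ext w
    have h0 : |x.coord w - y.coord w| ≤ 0 :=
      (le_csInf (s := {L | PathLength x y L}) (exists_pathLength x y)
        fun L p => PathLength.abs_le p w).trans_eq h
    exact sub_eq_zero.1 (abs_nonpos_iff.1 h0)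

/-- The map induced on points of the realisation by a graph automorphism. -/
noncomputable def map (φ : Γ ≃g Γ) (x : Realisation Γ hΓ) : Realisation Γ hΓ where
  coord := Finsupp.equivMapDomain φ.toEquiv x.coord
  nonneg := fun v => x.nonneg _
  sum_eq_one := by
    rw [Finsupp.sum_equivMapDomain]
    exact x.sum_eq_one
  supported := by
    obtain ⟨u, v, huv, h⟩ := x.supported
    refine ⟨φ u, φ v, huv.imp (congrArg φ) φ.map_adj_iff.2, fun w hw => ?_⟩
    have hw' : φ.symm w ∈ (x.coord.support : Set V) :=
      Finset.mem_coe.2 (Finsupp.mem_support_iff.2 (by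
        have := Finsupp.mem_support_iff.1 (Finset.mem_coe.1 hw)
        rwa [Finsupp.equivMapDomain_apply] at this))
    rcases h hw' with h | h
    · exact Or.inl (by rw [← h]; simp)
    · exact Or.inr (by rw [Set.mem_singleton_iff, ← Set.mem_singleton_iff.1 h]; simp)

theorem map_coord (φ : Γ ≃g Γ) (x : Realisation Γ hΓ) (v : V) :
    (map φ x).coord v = x.coord (φ.symm v) := rfl

theorem OnCell.map {x : Realisation Γ hΓ} {u v : V} (φ : Γ ≃g Γ) (h : x.OnCell u v) :
    (map φ x).OnCell (φ u) (φ v) := by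
  intro w hw
  by_contra hne
  simp only [Set.mem_insert_iff, Set.mem_singleton_iff, not_or] at hne
  refine Finsupp.mem_support_iff.1 (Finset.mem_coe.1 hw) ?_
  rw [map_coord]
  refine h.coord_eq_zero ?_ ?_
  · intro h; exact hne.1 (by rw [← h]; simp)
  · intro h; exact hne.2 (by rw [← h]; simp)

theorem PathLength.map {x y : Realisation Γ hΓ} {L : ℝ} (φ : Γ ≃g Γ) (p : PathLength x y L) :
    PathLength (Realisation.map φ x) (Realisation.map φ y) L := by
  induction p with
  | nil x => exact .nil _
  | cons u v huv hx hy p ih =>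
    have := PathLength.cons (φ u) (φ v) (huv.imp (congrArg φ) φ.map_adj_iff.2)
      (hx.map φ) (hy.map φ) ih
    simpa [map_coord] using this

theorem map_map (φ ψ : Γ ≃g Γ) (x : Realisation Γ hΓ) : map φ (map ψ x) = map (φ * ψ) x := by
  ext v
  rfl

theorem map_one (x : Realisation Γ hΓ) : map (1 : Γ ≃g Γ) x = x := by
  ext v
  rfl

theorem dist_map_le (φ : Γ ≃g Γ) (x y : Realisation Γ hΓ) :
    dist (map φ x) (map φ y) ≤ dist x y :=
  le_csInf (exists_pathLength x y) fun _ p =>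
    csInf_le ⟨0, fun _ p => PathLength.nonneg p⟩ (PathLength.map φ p)

/-- The action of the automorphism group of a connected graph on its geometric realisation. -/
noncomputable def autHom (Γ : SimpleGraph V) (hΓ : Γ.Connected) :
    (Γ ≃g Γ) →* (Realisation Γ hΓ ≃ᵢ Realisation Γ hΓ) where
  toFun φ :=
    { toFun := map φ
      invFun := map φ⁻¹
      left_inv := fun x => by rw [map_map, inv_mul_cancel, map_one]
      right_inv := fun x => by rw [map_map, mul_inv_cancel, map_one]
      isometry_toFun := Isometry.of_dist_eq fun x y => le_antisymm (dist_map_le φ x y) <| by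
        have := dist_map_le φ⁻¹ (map φ x) (map φ y)
        rwa [map_map, map_map, inv_mul_cancel, map_one, map_one] at this }
  map_one' := by
    ext1 x
    exact map_one x
  map_mul' φ ψ := by
    ext1 x
    exact (map_map φ ψ x).symm

end Realisation

/-- The stabiliser in `G` of a vertex, for an action of `G` by graph automorphisms. -/
def vertexStabiliser {G : Type*} [Group G] {Γ : SimpleGraph V} (φ : G →* (Γ ≃g Γ)) (v : V) :
    Subgroup G where
  carrier := {g | φ g v = v}
  one_mem' := by
    change φ 1 v = v
    rw [_root_.map_one]; rfl
  mul_mem' := fun {g h} hg hh => by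
    change φ g v = v at hg
    change φ h v = v at hh
    change φ (g * h) v = v
    rw [_root_.map_mul, RelIso.mul_apply, hh, hg]
  inv_mem' := fun {g} hg => by
    change φ g v = v at hg
    change φ g⁻¹ v = v
    conv_lhs => rw [← hg]
    rw [_root_.map_inv, RelIso.inv_apply_self]

end Realisation

/-!
A real tree, and the geometric realisation of a simplicial tree, are both geodesic spaces that
satisfy Gromov's four-point condition with `δ = 0` (`IsRealTree.isGeodesicZeroHyperbolic`,
`Realisation.isGeodesicZeroHyperbolic`). For real trees, medians exist because two segments from
the same point agree up to a last parameter. For simplicial trees, a choice of root gives an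
isometric embedding into `ℓ¹(V)`, for which Gromov products at the root are visibly ultrametric.
Everything else only uses these two properties.

Let `g` and `h` be isometries of such a space. One without fixed points translates a geodesic line
(`exists_axis`), and every point has a projection to that line (`exists_projection`). All free
groups come from ping-pong for two cyclic groups.

* If `g` fixes `x` and `h` fixes `y`, then either some powers of `g` and `h` fix the same point of
  `[x, y]`, or the set of points of `[x, y]` fixed by a power of `g` cuts the space into two sets
  that play ping-pong.
* If both have axes, then either points project arbitrarily far along both axes, in which case these
  share an end, or large powers play ping-pong.
* If `g` has an axis and `h` a fixed point, the fixed points of `h ^ n!` on the axis form increasing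
  intervals. If one of them is unbounded, `h ^ n!` fixes an end of the axis. Otherwise the
  stabilisation property keeps their lengths bounded. Then no power of `h` fixes a point of the axis
  far from the projection of the fixed point of `h`, at most one power exchanges the two sides, and
  ping-pong is possible after passing to powers.

Only the last case uses the stabilisation property. The statements on the power alternative follow
by taking further powers inside a stabiliser; for a simplicial tree the square of an automorphism
that fixes a point of an edge fixes a vertex.
-/

/-! ### Geodesic zero-hyperbolic spaces -/

/-- A metric space that is geodesic and satisfies Gromov's four-point condition with `δ = 0`. Both
real trees and geometric realisations of simplicial trees are of this kind. -/
structure IsGeodesicZeroHyperbolic (T : Type*) [MetricSpace T] : Prop where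
  four_point : ∀ x y z w : T,
    dist x y + dist z w ≤ max (dist x z + dist y w) (dist x w + dist y z)
  exists_between : ∀ (x y : T) (t : ℝ), 0 ≤ t → t ≤ dist x y →
    ∃ z, dist x z = t ∧ dist z y = dist x y - t

namespace IsGeodesicZeroHyperbolic

variable {T : Type*} [MetricSpace T]

theorem eq_of_between (hT : IsGeodesicZeroHyperbolic T) {x y m m' : T}
    (h : dist x m + dist m y = dist x y) (h' : dist x m' + dist m' y = dist x y)
    (he : dist x m = dist x m') : m = m' := by
  have := hT.four_point m m' x y
  rw [dist_comm m x, dist_comm m' x] at this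
  refine dist_le_zero.1 ?_
  rcases le_max_iff.1 this with h1 | h1 <;> linarith

theorem exists_segment (hT : IsGeodesicZeroHyperbolic T) (x y : T) :
    ∃ σ : ℝ → T, σ 0 = x ∧ σ (dist x y) = y ∧
      ∀ s ∈ Set.Icc 0 (dist x y), ∀ t ∈ Set.Icc 0 (dist x y), dist (σ s) (σ t) = |s - t| := by
  have h : ∀ t : ℝ, ∃ z, t ∈ Set.Icc 0 (dist x y) → dist x z = t ∧ dist z y = dist x y - t := by
    intro t
    by_cases ht : t ∈ Set.Icc 0 (dist x y)
    · obtain ⟨z, hz⟩ := hT.exists_between x y t ht.1 ht.2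
      exact ⟨z, fun _ => hz⟩
    · exact ⟨x, fun h => absurd h ht⟩
  choose σ hσ using h
  have h0 := hσ 0 ⟨le_rfl, dist_nonneg⟩
  have h1 := hσ (dist x y) ⟨dist_nonneg, le_rfl⟩
  refine ⟨σ, (dist_eq_zero.1 h0.1).symm, dist_eq_zero.1 (by rw [h1.2, sub_self]), ?_⟩
  intro s hs t ht
  have hs' := hσ s hs
  have ht' := hσ t ht
  apply le_antisymm
  · have := hT.four_point (σ s) (σ t) x y
    rw [dist_comm (σ s) x, dist_comm (σ t) x] at this
    rcases le_max_iff.1 this with h1 | h1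
    · have := le_abs_self (s - t); linarith
    · have := neg_abs_le (s - t); linarith
  · have h1 := dist_triangle x (σ s) (σ t)
    have h2 := dist_triangle x (σ t) (σ s)
    rw [dist_comm (σ t)] at h2
    rw [abs_le]
    constructor <;> linarith

/-- An isometry without fixed points translates a geodesic line. -/
theorem exists_axis [Nonempty T] (hT : IsGeodesicZeroHyperbolic T) (f : T ≃ᵢ T)
    (hf : ∀ x, f x ≠ x) :
    ∃ (γ : ℝ → T) (l : ℝ), Isometry γ ∧ 0 < l ∧ ∀ t, f (γ t) = γ (t + l) := by
  obtain ⟨x⟩ := ‹Nonempty T›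
  have hd : 0 < dist x (f x) := dist_pos.2 (hf x).symm
  set d := dist x (f x) with hd_def
  have hd1 : dist (f x) (f (f x)) = d := f.dist_eq _ _
  set e := dist x (f (f x)) with he_def
  -- Otherwise the midpoint of `[x, f x]` is fixed.
  have hde : d < e := by
    by_contra! hle
    obtain ⟨m, hm1, hm2⟩ := hT.exists_between x (f x) (d / 2) (by linarith) (by linarith)
    have h4 := hT.four_point m (f (f x)) x (f x)
    rw [dist_comm m x, dist_comm (f (f x)) (f x), dist_comm (f (f x)) x] at h4
    have h5 : dist m (f (f x)) ≤ d / 2 := by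
      rcases le_max_iff.1 h4 with h | h <;> linarith
    have h6 := dist_triangle (f x) m (f (f x))
    have h7 : dist (f x) (f m) = dist x m := f.dist_eq _ _
    have h8 : dist (f m) (f (f x)) = dist m (f x) := f.dist_eq _ _
    rw [dist_comm (f x) m] at h6
    refine hf m (hT.eq_of_between (x := f x) (y := f (f x)) ?_ ?_ ?_)
    · linarith
    · rw [dist_comm (f x) m]; linarith
    · rw [dist_comm (f x) m]; linarith
  have he2 : e ≤ d + d := (dist_triangle x (f x) (f (f x))).trans_eq (by rw [hd1])
  -- The point of `[x, f x]` closest to the axis; `c` is its distance from `x`.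
  set c := (2 * d - e) / 2 with hc
  obtain ⟨σ, hσ0, hσ1, hσ⟩ := hT.exists_segment x (f x)
  rw [← hd_def] at hσ1 hσ
  have hcI : c ∈ Set.Icc 0 d := ⟨by linarith, by linarith⟩
  have hdcI : d - c ∈ Set.Icc 0 d := ⟨by linarith, by linarith⟩
  have h0I : (0 : ℝ) ∈ Set.Icc 0 d := ⟨by linarith, by linarith⟩
  have hdI : d ∈ Set.Icc 0 d := ⟨by linarith, by linarith⟩
  set p := σ c with hp
  have hxp : dist x p = c := by
    have := hσ 0 h0I c hcI
    rwa [hσ0, zero_sub, abs_neg, abs_of_nonneg hcI.1] at this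
  have hpx : dist p (f x) = d - c := by
    have := hσ c hcI d hdI
    rwa [hσ1, abs_sub_comm, abs_of_nonneg (by linarith)] at this
  have hxq : dist x (σ (d - c)) = d - c := by
    have := hσ 0 h0I _ hdcI
    rwa [hσ0, zero_sub, abs_neg, abs_of_nonneg hdcI.1] at this
  have hqx : dist (σ (d - c)) (f x) = c := by
    have := hσ _ hdcI d hdI
    rwa [hσ1, abs_sub_comm, abs_of_nonneg (by linarith), sub_sub_cancel] at this
  -- The segments `[f x, x]` and `[f x, f (f x)]` overlap in length `c`.
  have hq : σ (d - c) = f p := by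
    have h4 := hT.four_point (σ (d - c)) (f (f x)) x (f x)
    rw [dist_comm _ x, dist_comm (f (f x)) (f x), dist_comm (f (f x)) x] at h4
    have h5 : dist (σ (d - c)) (f (f x)) ≤ d - c := by
      rcases le_max_iff.1 h4 with h | h <;> linarith
    have h6 := dist_triangle (f x) (σ (d - c)) (f (f x))
    have h7 : dist (f x) (f p) = dist x p := f.dist_eq _ _
    have h8 : dist (f p) (f (f x)) = dist p (f x) := f.dist_eq _ _
    rw [dist_comm (f x) (σ (d - c))] at h6
    refine hT.eq_of_between (x := f x) (y := f (f x)) ?_ ?_ ?_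
    · rw [dist_comm (f x) (σ (d - c))]; linarith
    · linarith
    · rw [dist_comm (f x) (σ (d - c))]; linarith
  set l := d - 2 * c with hl
  have hl0 : 0 < l := by linarith
  have hpl : dist p (f p) = l := by
    rw [← hq, hp, hσ c hcI _ hdcI, abs_sub_comm, abs_of_nonneg (by linarith)]
    linarith
  have hpl2 : dist p (f (f p)) = 2 * l := by
    apply le_antisymm
    · have := dist_triangle p (f p) (f (f p))
      have h7 : dist (f p) (f (f p)) = dist p (f p) := f.dist_eq _ _
      linarith
    · have h1 := dist_triangle x p (f (f p))
      have h2 := dist_triangle x (f (f p)) (f (f x))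
      have h7 : dist (f (f p)) (f (f x)) = dist p x := by rw [f.dist_eq, f.dist_eq]
      rw [dist_comm p x] at h7
      linarith
  have hz : ∀ (i : ℤ) (a b : T), dist ((f ^ i) a) ((f ^ i) b) = dist a b :=
    fun i a b => (f ^ i).dist_eq a b
  -- Each step applies the four-point condition to `p`, `f p` and two successive points of the orbit.
  have hnat : ∀ n : ℕ, dist p ((f ^ n) p) = n * l := by
    intro n
    induction n using Nat.strong_induction_on with
    | _ n ih =>
      match n, ih with
      | 0, _ => simp
      | 1, _ => simpa using hpl
      | 2, _ => simpa [pow_two] using hpl2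
      | (n + 3), ih =>
        have h1 := ih (n + 1) (by omega)
        have h2 := ih (n + 2) (by omega)
        have e1 : (f ^ (n + 3)) p = f ((f ^ (n + 2)) p) := by
          rw [pow_succ' f (n + 2)]; rfl
        have e2 : (f ^ (n + 2)) p = f ((f ^ (n + 1)) p) := by
          rw [pow_succ' f (n + 1)]; rfl
        have h4 := hT.four_point p ((f ^ (n + 2)) p) (f p) ((f ^ (n + 3)) p)
        have h5 : dist (f p) ((f ^ (n + 3)) p) = dist p ((f ^ (n + 2)) p) := by
          rw [e1, f.dist_eq]
        have h6 : dist (f p) ((f ^ (n + 2)) p) = dist p ((f ^ (n + 1)) p) := by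
          rw [e2, f.dist_eq]
        have h7 : dist ((f ^ (n + 2)) p) ((f ^ (n + 3)) p) = l := by
          have : (f ^ (n + 3)) p = (f ^ (n + 2)) (f p) := by
            rw [pow_succ f (n + 2)]; rfl
          rw [this, (f ^ (n + 2)).dist_eq, hpl]
        have h8 := dist_triangle p ((f ^ (n + 2)) p) ((f ^ (n + 3)) p)
        rw [dist_comm ((f ^ (n + 2)) p) (f p)] at h4
        push_cast at *
        have hn : 0 ≤ (n : ℝ) * l := by positivity
        rcases le_max_iff.1 h4 with h | h
        · nlinarith
        · apply le_antisymm <;> linarith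
  have hint : ∀ i j : ℤ, i ≤ j → dist ((f ^ i) p) ((f ^ j) p) = (j - i) * l := by
    intro i j hij
    obtain ⟨n, rfl⟩ := Int.le.dest hij
    rw [zpow_add, IsometryEquiv.mul_apply, hz, zpow_natCast, hnat]
    push_cast; ring
  -- The axis is the union of the translates of `[p, f p]`.
  obtain ⟨τ, hτ0, hτ1, hτ⟩ := hT.exists_segment p (f p)
  rw [hpl] at hτ1 hτ
  have hfl : ∀ t : ℝ, (⌊t / l⌋ : ℝ) * l ≤ t ∧ t < (⌊t / l⌋ + 1) * l := fun t =>
    ⟨(le_div_iff₀ hl0).1 (Int.floor_le _), (div_lt_iff₀ hl0).1 (Int.lt_floor_add_one _)⟩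
  have hmem : ∀ t : ℝ, t - ⌊t / l⌋ * l ∈ Set.Icc 0 l := fun t =>
    ⟨by linarith [(hfl t).1], by linarith [(hfl t).2]⟩
  have h0l : (0 : ℝ) ∈ Set.Icc 0 l := ⟨le_rfl, hl0.le⟩
  have hll : l ∈ Set.Icc 0 l := ⟨hl0.le, le_rfl⟩
  set γ : ℝ → T := fun t => (f ^ ⌊t / l⌋) (τ (t - ⌊t / l⌋ * l)) with hγ
  have hleft : ∀ t, dist ((f ^ ⌊t / l⌋) p) (γ t) = t - ⌊t / l⌋ * l := by
    intro t
    rw [hγ, hz, ← hτ0, hτ 0 h0l _ (hmem t), zero_sub, abs_neg, abs_of_nonneg (hmem t).1]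
  have hright : ∀ t, dist (γ t) ((f ^ (⌊t / l⌋ + 1)) p) = (⌊t / l⌋ + 1) * l - t := by
    intro t
    rw [zpow_add_one, IsometryEquiv.mul_apply, hγ, hz, ← hτ1, hτ _ (hmem t) l hll, abs_sub_comm,
      abs_of_nonneg (by linarith [(hmem t).2])]
    ring
  have hdist : ∀ s t, s ≤ t → dist (γ s) (γ t) = t - s := by
    intro s t hst
    have hij : ⌊s / l⌋ ≤ ⌊t / l⌋ := Int.floor_le_floor (by gcongr)
    rcases hij.eq_or_lt with hij | hij
    · simp only [hγ]
      rw [hij, hz, hτ _ (hij ▸ hmem s) _ (hmem t), abs_sub_comm, abs_of_nonneg (by linarith)]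
      ring
    · have h1 := hint (⌊s / l⌋ + 1) ⌊t / l⌋ hij
      have h2 := hint ⌊s / l⌋ (⌊t / l⌋ + 1) (by omega)
      have h3 := hleft s
      have h4 := hright s
      have h5 := hleft t
      have h6 := hright t
      have t1 := dist_triangle4 (γ s) ((f ^ (⌊s / l⌋ + 1)) p) ((f ^ ⌊t / l⌋) p) (γ t)
      have t2 := dist_triangle4 ((f ^ ⌊s / l⌋) p) (γ s) (γ t) ((f ^ (⌊t / l⌋ + 1)) p)
      push_cast at h1 h2
      apply le_antisymm <;> linarith
  refine ⟨γ, l, Isometry.of_dist_eq fun s t => ?_, hl0, fun t => ?_⟩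
  · rcases le_total s t with h | h
    · rw [hdist s t h, Real.dist_eq, abs_sub_comm, abs_of_nonneg (by linarith)]
    · rw [dist_comm, hdist t s h, Real.dist_eq, abs_of_nonneg (by linarith)]
  · have : (t + l) / l = t / l + 1 := by field_simp
    simp only [hγ]
    rw [this, Int.floor_add_one, add_comm ⌊t / l⌋ 1, zpow_add, zpow_one, IsometryEquiv.mul_apply]
    congr 3
    push_cast; ring

/-- The nearest-point projection to a geodesic line `γ`: the point `p` projects to `γ τ`, and lies
at distance `δ` from it. -/
theorem exists_projection (hT : IsGeodesicZeroHyperbolic T) {γ : ℝ → T} (hγ : Isometry γ) (p : T) :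
    ∃ τδ : ℝ × ℝ, ∀ s, dist p (γ s) = τδ.2 + |s - τδ.1| := by
  set F : ℝ → ℝ := fun s => dist p (γ s) with hF
  have hg : ∀ s t, dist (γ s) (γ t) = |s - t| := fun s t => by rw [hγ.dist_eq, Real.dist_eq]
  have hlip : ∀ s t, F s ≤ F t + |s - t| := fun s t => by
    have := dist_triangle p (γ t) (γ s)
    rw [hg, abs_sub_comm] at this
    exact this
  have hconv : ∀ a b c, a ≤ b → b ≤ c → F b = max (F a - (b - a)) (F c - (c - b)) := by
    intro a b c hab hbc
    have h4 := hT.four_point p (γ b) (γ a) (γ c)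
    rw [hg, hg, hg, abs_sub_comm a c, abs_sub_comm b c, abs_of_nonneg (by linarith),
      abs_of_nonneg (by linarith), abs_of_nonneg (by linarith)] at h4
    have h1 := hlip a b
    have h2 := hlip c b
    rw [abs_sub_comm, abs_of_nonneg (by linarith)] at h1
    rw [abs_of_nonneg (by linarith)] at h2
    apply le_antisymm
    · change F b + (c - a) ≤ max (F a + (c - b)) (F c + (b - a)) at h4
      rcases le_max_iff.1 h4 with h | h
      · exact le_max_of_le_left (by linarith)
      · exact le_max_of_le_right (by linarith)
    · exact max_le (by linarith) (by linarith)
  have htri : ∀ s t, |s - t| ≤ F s + F t := fun s t => by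
    have := dist_triangle (γ s) p (γ t)
    rwa [hg, dist_comm _ p] at this
  set C := F 0 with hC
  have hC0 : 0 ≤ C := dist_nonneg
  -- The functions `s ↦ F s ∓ s` are constant near `±∞`; their values determine `F`.
  set A := F (-C) - C with hA
  set B := F C - C with hB
  have hfar : ∀ M, C ≤ M → F (-M) - M = A ∧ F M - M = B := by
    intro M hM
    have h1 := hconv (-M) (-C) M (by linarith) (by linarith)
    have h2 := hconv (-M) C M (by linarith) (by linarith)
    have h3 := hlip M 0
    have h4 := hlip (-M) 0
    have h5 := htri M 0
    have h6 := htri (-M) 0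
    simp only [sub_zero, abs_neg, abs_of_nonneg (hC0.trans hM)] at h3 h4 h5 h6
    rw [max_eq_left (by linarith)] at h1
    rw [max_eq_right (by linarith)] at h2
    constructor <;> linarith
  have hall : ∀ s, F s = (A + B) / 2 + |s - (A - B) / 2| := by
    intro s
    obtain ⟨h1, h2⟩ := hfar (max C |s|) (le_max_left _ _)
    have hs : |s| ≤ max C |s| := le_max_right _ _
    generalize max C |s| = M at h1 h2 hs
    rw [hconv (-M) s M (by linarith [neg_abs_le s]) (by linarith [le_abs_self s])]
    rcases le_total ((A - B) / 2) s with h | h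
    · rw [abs_of_nonneg (by linarith), max_eq_right (by linarith)]; linarith
    · rw [abs_of_nonpos (by linarith), max_eq_left (by linarith)]; linarith
  exact ⟨((A - B) / 2, (A + B) / 2), hall⟩

/-- The parameter of the projection of a point to a geodesic line. -/
noncomputable def proj (hT : IsGeodesicZeroHyperbolic T) {γ : ℝ → T} (hγ : Isometry γ) (p : T) :
    ℝ := (hT.exists_projection hγ p).choose.1

/-- The distance from a point to its projection to a geodesic line. -/
noncomputable def height (hT : IsGeodesicZeroHyperbolic T) {γ : ℝ → T} (hγ : Isometry γ) (p : T) :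
    ℝ := (hT.exists_projection hγ p).choose.2

section Line

variable (hT : IsGeodesicZeroHyperbolic T) {γ : ℝ → T} (hγ : Isometry γ)

theorem dist_line (p : T) (s : ℝ) :
    dist p (γ s) = hT.height hγ p + |s - hT.proj hγ p| :=
  (hT.exists_projection hγ p).choose_spec s

theorem eq_proj_of_forall {p : T} {τ δ : ℝ} (h : ∀ s, dist p (γ s) = δ + |s - τ|) :
    hT.proj hγ p = τ := by
  have h1 := h τ
  have h2 := h (hT.proj hγ p)
  rw [hT.dist_line hγ] at h1 h2
  rw [sub_self, abs_zero] at h1 h2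
  rw [abs_sub_comm] at h1
  have : |hT.proj hγ p - τ| = 0 := by linarith [abs_nonneg (hT.proj hγ p - τ)]
  linarith [abs_eq_zero.1 this]

theorem proj_line (t : ℝ) : hT.proj hγ (γ t) = t :=
  hT.eq_proj_of_forall hγ (δ := 0) fun s => by
    rw [hγ.dist_eq, Real.dist_eq, abs_sub_comm, zero_add]

theorem proj_translate {f : T ≃ᵢ T} {l : ℝ} (hf : ∀ t, f (γ t) = γ (t + l)) (p : T) :
    hT.proj hγ (f p) = hT.proj hγ p + l :=
  hT.eq_proj_of_forall hγ (δ := hT.height hγ p) fun s => by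
    have : γ s = f (γ (s - l)) := by rw [hf, sub_add_cancel]
    rw [this, f.dist_eq, hT.dist_line hγ]
    congr 2; ring

/-- The segment between two points with different projections runs through the line. -/
theorem dist_of_proj_lt {p q : T} (h : hT.proj hγ p < hT.proj hγ q) :
    dist p q = hT.height hγ p + (hT.proj hγ q - hT.proj hγ p) + hT.height hγ q := by
  have h1 := hT.dist_line hγ p (hT.proj hγ p)
  have h2 := hT.dist_line hγ p (hT.proj hγ q)
  have h3 := hT.dist_line hγ q (hT.proj hγ p)
  have h4 := hT.dist_line hγ q (hT.proj hγ q)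
  have h5 : dist (γ (hT.proj hγ p)) (γ (hT.proj hγ q)) = hT.proj hγ q - hT.proj hγ p := by
    rw [hγ.dist_eq, Real.dist_eq, abs_sub_comm, abs_of_nonneg (by linarith)]
  rw [sub_self, abs_zero] at h1 h4
  rw [abs_of_nonneg (by linarith)] at h2
  rw [abs_sub_comm, abs_of_nonneg (by linarith)] at h3
  have h6 := hT.four_point p (γ (hT.proj hγ q)) q (γ (hT.proj hγ p))
  rw [dist_comm (γ (hT.proj hγ q)) q, dist_comm (γ (hT.proj hγ q)) (γ (hT.proj hγ p))] at h6
  have h7 := dist_triangle p (γ (hT.proj hγ q)) q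
  rw [dist_comm (γ (hT.proj hγ q)) q] at h7
  rcases le_max_iff.1 h6 with h | h <;> apply le_antisymm <;> linarith

theorem between_of_proj {p q : T} {t : ℝ} (hp : hT.proj hγ p ≤ t) (hq : t < hT.proj hγ q) :
    dist p (γ t) + dist (γ t) q = dist p q := by
  rw [hT.dist_of_proj_lt hγ (hp.trans_lt hq), dist_comm (γ t), hT.dist_line hγ, hT.dist_line hγ,
    abs_of_nonneg (by linarith), abs_of_nonpos (by linarith)]
  ring

theorem between_of_proj' {p q : T} {t : ℝ} (hp : t ≤ hT.proj hγ p) (hq : hT.proj hγ q < t) :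
    dist p (γ t) + dist (γ t) q = dist p q := by
  rw [dist_comm p q, hT.dist_of_proj_lt hγ (hq.trans_le hp), dist_comm (γ t), hT.dist_line hγ,
    hT.dist_line hγ, abs_of_nonneg (a := t - hT.proj hγ q) (by linarith),
    abs_of_nonpos (by linarith)]
  ring

end Line

end IsGeodesicZeroHyperbolic

open scoped Pointwise in
/-- **Ping-pong** for two cyclic groups acting by isometries. -/
theorem nonempty_closure_mulEquiv_freeGroup_of_ping_pong {G T : Type*} [Group G] [MetricSpace T]
    (ρ : G →* (T ≃ᵢ T)) {g h : G} {X Y : Set T} (hX : X.Nonempty) (hY : Y.Nonempty)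
    (hXY : Disjoint X Y) (hg : ∀ k : ℤ, k ≠ 0 → ∀ p ∈ Y, ρ (g ^ k) p ∈ X)
    (hh : ∀ k : ℤ, k ≠ 0 → ∀ p ∈ X, ρ (h ^ k) p ∈ Y) :
    Nonempty (Subgroup.closure ({g, h} : Set G) ≃* FreeGroup (Fin 2)) := by
  let _ : MulAction G T :=
    { smul := fun a x => ρ a x
      one_smul := fun x => by change ρ 1 x = x; rw [_root_.map_one]; rfl
      mul_smul := fun a b x => by change ρ (a * b) x = _; rw [_root_.map_mul]; rfl }
  let a : Fin 2 → G := ![g, h]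
  let f : ∀ _ : Fin 2, FreeGroup Unit →* G := fun i => FreeGroup.lift fun _ => a i
  let Z : Fin 2 → Set T := ![X, Y]
  have hinj : Function.Injective (FreeGroup.lift a) := by
    have e : FreeGroup.lift a = (Monoid.CoprodI.lift f).comp
        (@freeGroupEquivCoprodI (Fin 2)).toMonoidHom := by
      ext i
      simp [f]
    rw [e, MonoidHom.coe_comp]
    refine Function.Injective.comp ?_ (MulEquiv.injective freeGroupEquivCoprodI)
    refine Monoid.CoprodI.lift_injective_of_ping_pong f ?_ Z ?_ ?_ ?_
    · refine Or.inr ⟨0, ?_⟩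
      rw [FreeGroup.freeGroupUnitEquivInt.cardinal_eq, Cardinal.mk_denumerable]
      exact (Cardinal.natCast_lt_aleph0 (n := 3)).le
    · intro i
      fin_cases i
      · exact hX
      · exact hY
    · intro i j hij
      fin_cases i <;> fin_cases j
      · exact absurd rfl hij
      · exact hXY
      · exact hXY.symm
      · exact absurd rfl hij
    · intro i j hij
      refine FreeGroup.freeGroupUnitEquivInt.forall_congr_left.mpr fun n hn => ?_
      have hn0 : n ≠ 0 := by
        rintro rfl
        exact hn (by simp [FreeGroup.freeGroupUnitEquivInt])
      change FreeGroup.lift (fun _ => a i) (FreeGroup.of () ^ n) • Z j ⊆ Z i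
      rw [map_zpow, FreeGroup.lift_apply_of]
      rintro _ ⟨p, hp, rfl⟩
      fin_cases i <;> fin_cases j
      · exact absurd rfl hij
      · exact hg n hn0 p hp
      · exact hh n hn0 p hp
      · exact absurd rfl hij
  have hr : (FreeGroup.lift a).range = Subgroup.closure {g, h} := by
    rw [FreeGroup.range_lift_eq_closure]
    congr 1
    simp [a, Matrix.range_cons, Set.pair_comm]
  exact ⟨((MonoidHom.ofInjective hinj).trans (MulEquiv.subgroupCongr hr)).symm⟩

/-! ### Pairs of isometries -/

section Actions

variable {G T : Type*} [Group G] [MetricSpace T]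

/-- Some common positive powers of `g` and `h` generate a free group of rank two, or fix a common
point of the space, or fix a common point of its boundary. -/
def HasFreeOrFixingPowers (ρ : G →* (T ≃ᵢ T)) (g h : G) : Prop :=
  ∃ n : ℕ, 1 ≤ n ∧
    (Nonempty (Subgroup.closure ({g ^ n, h ^ n} : Set G) ≃* FreeGroup (Fin 2)) ∨
      (∃ x : T, g ^ n ∈ pointStabiliser ρ x ∧ h ^ n ∈ pointStabiliser ρ x) ∨
      (∃ ξ : TreeBoundary T,
        g ^ n ∈ boundaryStabiliser ρ ξ ∧ h ^ n ∈ boundaryStabiliser ρ ξ))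

theorem HasFreeOrFixingPowers.symm {ρ : G →* (T ≃ᵢ T)} {g h : G}
    (H : HasFreeOrFixingPowers ρ g h) : HasFreeOrFixingPowers ρ h g := by
  obtain ⟨n, hn, H⟩ := H
  refine ⟨n, hn, ?_⟩
  rw [Set.pair_comm]
  exact H.imp id (Or.imp (fun ⟨x, a, b⟩ => ⟨x, b, a⟩) fun ⟨x, a, b⟩ => ⟨x, b, a⟩)

theorem mem_pointStabiliser {ρ : G →* (T ≃ᵢ T)} {g : G} {x : T} :
    g ∈ pointStabiliser ρ x ↔ ρ g x = x := Iff.rfl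

theorem exists_pow_mem_of_zpow_mem {H : Subgroup G} {g : G} {k : ℤ} (hk : k ≠ 0)
    (h : g ^ k ∈ H) : ∃ n : ℕ, 1 ≤ n ∧ g ^ n ∈ H := by
  refine ⟨k.natAbs, Int.natAbs_pos.2 hk, ?_⟩
  rcases Int.natAbs_eq k with h' | h'
  · rwa [h', zpow_natCast] at h
  · rw [h', zpow_neg, zpow_natCast] at h
    exact H.inv_mem_iff.1 h

theorem mem_boundaryStabiliser_of_dist_le {ρ : G →* (T ≃ᵢ T)} {g : G} {r : GeodesicRay T} {C : ℝ}
    (h : ∀ t, dist (ρ g (r.1 t)) (r.1 t) ≤ C) :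
    g ∈ boundaryStabiliser ρ (Quotient.mk (GeodesicRay.asymptotic T) r) :=
  Quotient.sound (s := GeodesicRay.asymptotic T) ⟨C, h⟩

/-- The positive half of a geodesic line. -/
def rayOfLine {γ : ℝ → T} (hγ : Isometry γ) : GeodesicRay T :=
  ⟨fun t => γ t, hγ.comp (Isometry.of_dist_eq fun _ _ => rfl)⟩

theorem zpow_translate {ρ : G →* (T ≃ᵢ T)} {g : G} {γ : ℝ → T} {l : ℝ}
    (hg : ∀ t, ρ g (γ t) = γ (t + l)) (k : ℤ) (t : ℝ) : ρ (g ^ k) (γ t) = γ (t + k * l) := by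
  induction k with
  | zero => simp
  | succ k ih =>
    rw [zpow_add_one, (Commute.zpow_self g _).eq, _root_.map_mul, IsometryEquiv.mul_apply, ih, hg]
    congr 1; push_cast; ring
  | pred k ih =>
    rw [zpow_sub_one, ((Commute.refl g).zpow_left _).inv_right.eq, _root_.map_mul,
      IsometryEquiv.mul_apply, ih]
    have : γ (t + ((-k : ℤ) : ℝ) * l) = ρ g (γ (t + ((-k - 1 : ℤ) : ℝ) * l)) := by
      rw [hg]; congr 1; push_cast; ring
    rw [this, _root_.map_inv, IsometryEquiv.inv_apply_self]

namespace IsGeodesicZeroHyperbolic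

/-- An isometry that fixes `x` and sends `p` to `q` sends the point of `[x, p]` at a given distance
from `x` to the point of `[x, q]` at that distance. -/
theorem apply_eq_of_between (hT : IsGeodesicZeroHyperbolic T) (f : T ≃ᵢ T) {x p a b : T}
    (hx : f x = x) (ha : dist x a + dist a p = dist x p)
    (hb : dist x b + dist b (f p) = dist x (f p)) (hab : dist x a = dist x b) : f a = b := by
  have h : ∀ z, dist x (f z) = dist x z := fun z => by
    conv_lhs => rw [← hx]
    exact f.dist_eq _ _
  refine hT.eq_of_between (x := x) (y := f p) ?_ hb ?_
  · rw [h, h, f.dist_eq, ha]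
  · rw [h, hab]

/-- Two elements with a fixed point each. The segment between the fixed points `x` and `y` is cut
where the powers of `g` stop fixing it, and the two sides play ping-pong. -/
theorem hasFreeOrFixingPowers_of_fixed_of_fixed (hT : IsGeodesicZeroHyperbolic T)
    (ρ : G →* (T ≃ᵢ T)) {g h : G} {x y : T} (hx : ρ g x = x) (hy : ρ h y = y) :
    HasFreeOrFixingPowers ρ g h := by
  obtain ⟨σ, hσ0, hσ1, hσ⟩ := hT.exists_segment x y
  set D := dist x y with hD
  have hD0 : 0 ≤ D := dist_nonneg
  by_cases hcommon : ∃ t, ∃ i j : ℕ, 1 ≤ i ∧ 1 ≤ j ∧ g ^ i ∈ pointStabiliser ρ (σ t) ∧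
      h ^ j ∈ pointStabiliser ρ (σ t)
  · obtain ⟨t, i, j, hi, hj, hgi, hhj⟩ := hcommon
    refine ⟨i * j, Nat.mul_pos hi hj, Or.inr (Or.inl ⟨σ t, ?_, ?_⟩)⟩
    · rw [pow_mul]; exact pow_mem hgi _
    · rw [mul_comm, pow_mul]; exact pow_mem hhj _
  push Not at hcommon
  set I : Set ℝ := {t | ∃ i : ℕ, 1 ≤ i ∧ g ^ i ∈ pointStabiliser ρ (σ t)} with hI
  -- The parameter of the projection of `p` to the segment, as a Gromov product.
  set τ : T → ℝ := fun p => (dist x p + D - dist p y) / 2 with hτ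
  have hτmem : ∀ p, τ p ∈ Set.Icc 0 D := fun p => by
    have h1 := dist_triangle x p y
    have h2 := dist_triangle p x y
    have h3 := dist_triangle x y p
    rw [dist_comm p x] at h2
    rw [dist_comm y p] at h3
    constructor <;> simp only [hτ] <;> linarith
  have hxσ : ∀ t ∈ Set.Icc 0 D, dist x (σ t) = t := fun t ht => by
    rw [← hσ0, hσ 0 ⟨le_rfl, hD0⟩ t ht, zero_sub, abs_neg, abs_of_nonneg ht.1]
  have hyσ : ∀ t ∈ Set.Icc 0 D, dist y (σ t) = D - t := fun t ht => by
    rw [← hσ1, hσ D ⟨hD0, le_rfl⟩ t ht, abs_of_nonneg (by linarith [ht.2])]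
  have hbx : ∀ p, ∀ t ∈ Set.Icc 0 D, t ≤ τ p → dist x (σ t) + dist (σ t) p = dist x p := by
    intro p t ht htp
    refine le_antisymm ?_ (dist_triangle _ _ _)
    have h4 := hT.four_point (σ t) p x y
    rw [dist_comm (σ t) x, dist_comm (σ t) y, ← hD, dist_comm p x, hxσ t ht, hyσ t ht] at h4
    rw [hxσ t ht]
    simp only [hτ] at htp
    rcases le_max_iff.1 h4 with h | h <;> linarith
  have hby : ∀ p, ∀ t ∈ Set.Icc 0 D, τ p ≤ t → dist y (σ t) + dist (σ t) p = dist y p := by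
    intro p t ht htp
    refine le_antisymm ?_ (dist_triangle _ _ _)
    have h4 := hT.four_point (σ t) p x y
    rw [dist_comm (σ t) x, dist_comm (σ t) y, ← hD, dist_comm p x, hxσ t ht, hyσ t ht] at h4
    rw [hyσ t ht]
    simp only [hτ] at htp
    rw [dist_comm p y] at *
    rcases le_max_iff.1 h4 with h | h <;> linarith
  refine ⟨1, le_rfl, Or.inl ?_⟩
  rw [pow_one, pow_one]
  refine nonempty_closure_mulEquiv_freeGroup_of_ping_pong ρ (X := {p | τ p ∈ I})
    (Y := {p | τ p ∉ I}) ⟨x, ?_⟩ ⟨y, ?_⟩ (Set.disjoint_left.2 fun p hp hp' => hp' hp) ?_ ?_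
  · have : τ x = 0 := by simp [hτ, hD]
    change τ x ∈ I
    rw [this]
    refine ⟨1, le_rfl, ?_⟩
    rw [pow_one, hσ0]
    exact hx
  · have : τ y = D := by simp [hτ, hD]
    change τ y ∉ I
    rw [this]
    rintro ⟨i, hi, hgi⟩
    refine hcommon D i 1 hi le_rfl hgi ?_
    rw [pow_one, hσ1]
    exact hy
  · intro k hk p hp
    by_contra hp'
    change τ p ∉ I at hp
    change τ (ρ (g ^ k) p) ∉ I at hp'
    have hmin : min (τ p) (τ (ρ (g ^ k) p)) ∉ I := by
      rcases min_choice (τ p) (τ (ρ (g ^ k) p)) with e | e <;> rwa [e]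
    have hmem : min (τ p) (τ (ρ (g ^ k) p)) ∈ Set.Icc 0 D := by
      rcases min_choice (τ p) (τ (ρ (g ^ k) p)) with e | e <;> rw [e] <;> exact hτmem _
    exact hmin (exists_pow_mem_of_zpow_mem hk
      (hT.apply_eq_of_between (ρ (g ^ k)) (zpow_mem (mem_pointStabiliser.2 hx) k)
        (hbx p _ hmem (min_le_left _ _)) (hbx _ _ hmem (min_le_right _ _)) rfl))
  · intro k hk p hp hp'
    change τ p ∈ I at hp
    have hmax : max (τ p) (τ (ρ (h ^ k) p)) ∈ I := by
      rcases max_choice (τ p) (τ (ρ (h ^ k) p)) with e | e <;> rwa [e]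
    have hmem : max (τ p) (τ (ρ (h ^ k) p)) ∈ Set.Icc 0 D := by
      rcases max_choice (τ p) (τ (ρ (h ^ k) p)) with e | e <;> rw [e] <;> exact hτmem _
    obtain ⟨i, hi, hgi⟩ := hmax
    obtain ⟨j, hj, hhj⟩ := exists_pow_mem_of_zpow_mem hk
      (mem_pointStabiliser.2 (hT.apply_eq_of_between (ρ (h ^ k))
        (zpow_mem (mem_pointStabiliser.2 hy) k)
        (hby p _ hmem (le_max_left _ _)) (hby _ _ hmem (le_max_right _ _)) rfl))
    exact hcommon _ i j hi hj hgi hhj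

/-- If some points project arbitrarily far along both lines, then the lines are asymptotic. -/
theorem exists_boundary_fixed (hT : IsGeodesicZeroHyperbolic T) (ρ : G →* (T ≃ᵢ T)) {g h : G}
    {γ η : ℝ → T} {l m : ℝ} (hγ : Isometry γ) (hη : Isometry η)
    (hg : ∀ t, ρ g (γ t) = γ (t + l)) (hh : ∀ t, ρ h (η t) = η (t + m))
    (H : ∀ n : ℕ, ∃ p, n < hT.proj hγ p ∧ n < hT.proj hη p) :
    ∃ ξ : TreeBoundary T, g ∈ boundaryStabiliser ρ ξ ∧ h ∈ boundaryStabiliser ρ ξ := by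
  have hdist : ∀ t : ℝ, 0 ≤ t → dist (γ t) (η t) ≤ dist (γ 0) (η 0) := by
    intro t ht
    obtain ⟨n, hn⟩ := exists_nat_ge t
    obtain ⟨p, hp1, hp2⟩ := H n
    have a0 := hT.dist_line hγ p 0
    have a1 := hT.dist_line hγ p t
    have b0 := hT.dist_line hη p 0
    have b1 := hT.dist_line hη p t
    rw [abs_of_nonpos (by linarith)] at a0 a1 b0 b1
    have c1 : dist (γ t) (γ 0) = t := by
      rw [hγ.dist_eq, Real.dist_eq, sub_zero, abs_of_nonneg ht]
    have c2 : dist (η t) (η 0) = t := by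
      rw [hη.dist_eq, Real.dist_eq, sub_zero, abs_of_nonneg ht]
    have h4 := hT.four_point (γ t) (η t) (γ 0) p
    have h5 := dist_triangle (η t) (η 0) (γ 0)
    have h6 := dist_triangle p (γ 0) (η 0)
    rw [dist_comm (η 0)] at h5
    rw [dist_comm (γ 0) p, dist_comm (η t) p, dist_comm (γ t) p] at h4
    rcases le_max_iff.1 h4 with h | h <;> linarith
  refine ⟨Quotient.mk (GeodesicRay.asymptotic T) (rayOfLine hγ), ?_, ?_⟩
  · refine mem_boundaryStabiliser_of_dist_le (C := |l|) fun t => ?_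
    change dist (ρ g (γ t)) (γ t) ≤ _
    rw [hg, hγ.dist_eq, Real.dist_eq, add_sub_cancel_left]
  · refine mem_boundaryStabiliser_of_dist_le
      (C := dist (γ 0) (η 0) + |m| + dist (γ 0) (η 0)) fun t => ?_
    change dist (ρ h (γ t)) (γ t) ≤ _
    refine (dist_triangle4 _ (ρ h (η t)) (η t) _).trans ?_
    rw [(ρ h).dist_eq, dist_comm (η t) (γ t), hh, hη.dist_eq, Real.dist_eq, add_sub_cancel_left]
    have := hdist t t.2
    linarith

theorem proj_reverse (hT : IsGeodesicZeroHyperbolic T) {γ : ℝ → T} (hγ : Isometry γ)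
    (hγ' : Isometry fun t => γ (-t)) (p : T) : hT.proj hγ' p = -hT.proj hγ p :=
  hT.eq_proj_of_forall hγ' (δ := hT.height hγ p) fun s => by
    rw [hT.dist_line hγ, ← abs_neg]
    congr 2; ring

theorem lt_abs_proj_zpow (hT : IsGeodesicZeroHyperbolic T) (ρ : G →* (T ≃ᵢ T)) {g : G}
    {γ : ℝ → T} {l : ℝ} (hγ : Isometry γ) (hg : ∀ t, ρ g (γ t) = γ (t + l)) (hl : 0 < l)
    {n : ℕ} {L : ℝ} (hn : 2 * L < n * l) (c : ℝ) {k : ℤ} (hk : k ≠ 0) {p : T}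
    (hp : |hT.proj hγ p - c| ≤ L) : L < |hT.proj hγ (ρ ((g ^ n) ^ k) p) - c| := by
  have h1 : (g ^ n) ^ k = g ^ (n * k : ℤ) := by rw [zpow_mul, zpow_natCast]
  rw [h1, hT.proj_translate hγ (zpow_translate hg _)]
  have hk1 : (1 : ℝ) ≤ |(k : ℝ)| := by exact_mod_cast Int.one_le_abs hk
  have h2 : |((n * k : ℤ) : ℝ) * l| = n * l * |(k : ℝ)| := by
    push_cast
    rw [abs_mul, abs_mul, abs_of_pos hl, Nat.abs_cast]
    ring
  have h3 : n * l ≤ n * l * |(k : ℝ)| := le_mul_of_one_le_right (by positivity) hk1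
  have h4 := abs_sub_abs_le_abs_sub (((n * k : ℤ) : ℝ) * l) (-(hT.proj hγ p - c))
  rw [abs_neg, sub_neg_eq_add] at h4
  have h5 : ((n * k : ℤ) : ℝ) * l + (hT.proj hγ p - c) =
    hT.proj hγ p + ((n * k : ℤ) : ℝ) * l - c := by ring
  rw [h5] at h4
  linarith

/-- Two elements with an axis each: either the axes have a common end, or large powers play
ping-pong with the sets of points that project far from the origin of the respective axis. -/
theorem hasFreeOrFixingPowers_of_axis_of_axis (hT : IsGeodesicZeroHyperbolic T)
    (ρ : G →* (T ≃ᵢ T)) {g h : G} {γ η : ℝ → T} {l m : ℝ} (hγ : Isometry γ) (hη : Isometry η)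
    (hl : 0 < l) (hm : 0 < m) (hg : ∀ t, ρ g (γ t) = γ (t + l))
    (hh : ∀ t, ρ h (η t) = η (t + m)) : HasFreeOrFixingPowers ρ g h := by
  by_cases hend : ∃ ξ : TreeBoundary T, g ∈ boundaryStabiliser ρ ξ ∧ h ∈ boundaryStabiliser ρ ξ
  · obtain ⟨ξ, h1, h2⟩ := hend
    exact ⟨1, le_rfl, Or.inr (Or.inr ⟨ξ, by rwa [pow_one], by rwa [pow_one]⟩)⟩
  have hγ' : Isometry fun t => γ (-t) := hγ.comp (IsometryEquiv.neg ℝ).isometry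
  have hη' : Isometry fun t => η (-t) := hη.comp (IsometryEquiv.neg ℝ).isometry
  have hg' : ∀ t, ρ g (γ (-t)) = γ (-(t + -l)) := fun t => by rw [hg]; congr 1; ring
  have hh' : ∀ t, ρ h (η (-t)) = η (-(t + -m)) := fun t => by rw [hh]; congr 1; ring
  have b1 := mt (hT.exists_boundary_fixed ρ hγ hη hg hh) hend
  have b2 := mt (hT.exists_boundary_fixed ρ hγ hη' hg hh') hend
  have b3 := mt (hT.exists_boundary_fixed ρ hγ' hη hg' hh) hend
  have b4 := mt (hT.exists_boundary_fixed ρ hγ' hη' hg' hh') hend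
  simp only [hT.proj_reverse hγ, hT.proj_reverse hη] at b2 b3 b4
  push Not at b1 b2 b3 b4
  obtain ⟨n1, b1⟩ := b1
  obtain ⟨n2, b2⟩ := b2
  obtain ⟨n3, b3⟩ := b3
  obtain ⟨n4, b4⟩ := b4
  set N : ℝ := n1 + n2 + n3 + n4 with hN
  have i1 : (0 : ℝ) ≤ n1 := n1.cast_nonneg
  have i2 : (0 : ℝ) ≤ n2 := n2.cast_nonneg
  have i3 : (0 : ℝ) ≤ n3 := n3.cast_nonneg
  have i4 : (0 : ℝ) ≤ n4 := n4.cast_nonneg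
  have hN0 : 0 ≤ N := by positivity
  have key : ∀ p, ¬ (N < |hT.proj hγ p - 0| ∧ N < |hT.proj hη p - 0|) := by
    rintro p ⟨hp1, hp2⟩
    rw [sub_zero] at hp1 hp2
    rcases lt_abs.1 hp1 with hp1 | hp1 <;> rcases lt_abs.1 hp2 with hp2 | hp2
    · linarith [b1 p (by linarith)]
    · linarith [b2 p (by linarith)]
    · linarith [b3 p (by linarith)]
    · linarith [b4 p (by linarith)]
  obtain ⟨n, hn⟩ := exists_nat_gt (max (2 * N / l) (2 * N / m))
  have hn1 := (div_lt_iff₀ hl).1 ((le_max_left _ _).trans_lt hn)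
  have hn2 := (div_lt_iff₀ hm).1 ((le_max_right _ _).trans_lt hn)
  have hn0 : 1 ≤ n := by
    rw [Nat.one_le_iff_ne_zero]
    rintro rfl
    rw [Nat.cast_zero, zero_mul] at hn1
    linarith
  refine ⟨n, hn0, Or.inl (nonempty_closure_mulEquiv_freeGroup_of_ping_pong ρ
    (X := {p | N < |hT.proj hγ p - 0|}) (Y := {p | N < |hT.proj hη p - 0|})
    ⟨γ (N + 1), ?_⟩ ⟨η (N + 1), ?_⟩ (Set.disjoint_left.2 fun p h1 h2 => key p ⟨h1, h2⟩)
    ?_ ?_)⟩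
  · change N < |hT.proj hγ (γ (N + 1)) - 0|
    rw [hT.proj_line hγ, sub_zero, abs_of_pos (by linarith)]
    linarith
  · change N < |hT.proj hη (η (N + 1)) - 0|
    rw [hT.proj_line hη, sub_zero, abs_of_pos (by linarith)]
    linarith
  · intro k hk p hp
    exact hT.lt_abs_proj_zpow ρ hγ hg hl hn1 0 hk (not_lt.1 fun h => key p ⟨h, hp⟩)
  · intro k hk p hp
    exact hT.lt_abs_proj_zpow ρ hη hh hm hn2 0 hk (not_lt.1 fun h => key p ⟨hp, h⟩)

/-- Under the stabilisation property, if no power of `h` fixes a half-line of the line `γ`, then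
the powers of `h` only fix points in a bounded part of `γ`. -/
theorem isBounded_fixed_of_hasStabilisation (hT : IsGeodesicZeroHyperbolic T)
    {ρ : G →* (T ≃ᵢ T)} (hρ : HasStabilisation ρ) {γ : ℝ → T} (hγ : Isometry γ) (h : G)
    (hb : ∀ n : ℕ, 1 ≤ n → Bornology.IsBounded {t | h ^ n ∈ pointStabiliser ρ (γ t)}) :
    Bornology.IsBounded {t | ∃ n : ℕ, 1 ≤ n ∧ h ^ n ∈ pointStabiliser ρ (γ t)} := by
  set I : ℕ → Set ℝ := fun n => {t | h ^ n.factorial ∈ pointStabiliser ρ (γ t)} with hI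
  set U : Set ℝ := {t | ∃ n : ℕ, 1 ≤ n ∧ h ^ n ∈ pointStabiliser ρ (γ t)} with hU
  have hmono : Monotone I := fun i j hij t ht => by
    obtain ⟨d, hd⟩ := Nat.factorial_dvd_factorial hij
    change h ^ j.factorial ∈ pointStabiliser ρ (γ t)
    rw [hd, pow_mul]
    exact pow_mem ht d
  have hUI : ∀ t ∈ U, ∃ n, t ∈ I n := by
    rintro t ⟨n, hn, ht⟩
    obtain ⟨d, hd⟩ := Nat.dvd_factorial hn le_rfl
    refine ⟨n, ?_⟩
    change h ^ n.factorial ∈ pointStabiliser ρ (γ t)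
    rw [hd, pow_mul]
    exact pow_mem ht d
  have hord : ∀ n, (I n).OrdConnected := by
    refine fun n => ⟨fun a ha b hb t ht => ?_⟩
    have hd : ∀ s u, s ≤ u → dist (γ s) (γ u) = u - s := fun s u hsu => by
      rw [hγ.dist_eq, Real.dist_eq, abs_sub_comm, abs_of_nonneg (by linarith)]
    have hbt : dist (γ a) (γ t) + dist (γ t) (γ b) = dist (γ a) (γ b) := by
      rw [hd _ _ ht.1, hd _ _ ht.2, hd _ _ (ht.1.trans ht.2)]; ring
    refine hT.apply_eq_of_between (ρ (h ^ n.factorial)) ha hbt ?_ rfl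
    rw [mem_pointStabiliser.1 hb]
    exact hbt
  by_contra hunb
  have htend : Tendsto (fun n => volume (I n)) atTop (𝓝 (∞ : ℝ≥0∞)) := by
    rw [ENNReal.tendsto_nhds_top_iff_nat]
    intro M
    rw [Metric.isBounded_iff] at hunb
    push Not at hunb
    obtain ⟨a, ha, b, hb, hab⟩ := hunb M
    obtain ⟨i, hi⟩ := hUI a ha
    obtain ⟨j, hj⟩ := hUI b hb
    filter_upwards [eventually_ge_atTop (max i j)] with n hn
    have hsub : Set.uIcc a b ⊆ I n := (hord n).uIcc_subset
      (hmono ((le_max_left _ _).trans hn) hi) (hmono ((le_max_right _ _).trans hn) hj)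
    refine lt_of_lt_of_le ?_ (measure_mono hsub)
    rw [Real.volume_interval, abs_sub_comm, ← Real.dist_eq, ← ENNReal.ofReal_natCast]
    exact (ENNReal.ofReal_lt_ofReal_iff_of_nonneg (Nat.cast_nonneg _)).2 hab
  obtain ⟨N, hN⟩ := hρ (fun _ => γ) I
    (fun n => ⟨hord n, fun s _ t _ => by rw [hγ.dist_eq, Real.dist_eq]⟩)
    (Or.inl fun n => Set.image_mono (hmono n.le_succ)) htend
  have hconst : ∀ n, N ≤ n → pointwiseStabiliser ρ (γ '' I N) = pointwiseStabiliser ρ (γ '' I n) :=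
    fun n hn => Nat.le_induction rfl (fun k hk ih => ih.trans (hN k hk)) n hn
  refine hunb ((hb N.factorial N.factorial_pos).subset fun t ht => ?_)
  obtain ⟨n, hn⟩ := hUI t ht
  have hmem : h ^ N.factorial ∈ pointwiseStabiliser ρ (γ '' I N) := by
    simp only [pointwiseStabiliser, Subgroup.mem_iInf]
    rintro _ ⟨s, hs, rfl⟩
    exact hs
  rw [hconst (max N n) (le_max_left _ _)] at hmem
  simp only [pointwiseStabiliser, Subgroup.mem_iInf] at hmem
  exact hmem _ ⟨t, hmono (le_max_right _ _) hn, rfl⟩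

/-- An isometry that fixes an unbounded set of points of a line fixes one of its ends. -/
theorem exists_boundary_fixed_of_not_isBounded (hT : IsGeodesicZeroHyperbolic T)
    (ρ : G →* (T ≃ᵢ T)) {g h : G} {γ : ℝ → T} {l : ℝ} (hγ : Isometry γ)
    (hg : ∀ t, ρ g (γ t) = γ (t + l))
    (hb : ¬ Bornology.IsBounded {t | h ∈ pointStabiliser ρ (γ t)}) :
    ∃ ξ : TreeBoundary T, g ∈ boundaryStabiliser ρ ξ ∧ h ∈ boundaryStabiliser ρ ξ := by
  -- If `h` fixes `γ t₀` and points `γ t` with `t` arbitrarily large, then it fixes `γ t` for all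
  -- `t ≥ t₀`.
  have main : ∀ (γ : ℝ → T) (l : ℝ), Isometry γ → (∀ t, ρ g (γ t) = γ (t + l)) →
      (∀ M : ℝ, ∃ t, M ≤ t ∧ h ∈ pointStabiliser ρ (γ t)) →
      ∃ ξ : TreeBoundary T, g ∈ boundaryStabiliser ρ ξ ∧ h ∈ boundaryStabiliser ρ ξ := by
    intro γ l hγ hg H
    refine ⟨Quotient.mk (GeodesicRay.asymptotic T) (rayOfLine hγ), ?_, ?_⟩
    · refine mem_boundaryStabiliser_of_dist_le (C := |l|) fun t => ?_
      change dist (ρ g (γ t)) (γ t) ≤ _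
      rw [hg, hγ.dist_eq, Real.dist_eq, add_sub_cancel_left]
    · obtain ⟨t0, ht0, hf0⟩ := H 0
      refine mem_boundaryStabiliser_of_dist_le (C := 2 * t0) fun t => ?_
      change dist (ρ h (γ t)) (γ t) ≤ _
      have hd : ∀ s u, dist (γ s) (γ u) = |s - u| := fun s u => by rw [hγ.dist_eq, Real.dist_eq]
      have ht : (0 : ℝ) ≤ t := t.2
      rcases le_total (t : ℝ) t0 with htt | htt
      · have := dist_triangle (ρ h (γ t)) (γ t0) (γ t)
        rw [← mem_pointStabiliser.1 hf0, (ρ h).dist_eq, mem_pointStabiliser.1 hf0,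
          dist_comm (γ t0), hd, abs_sub_comm, abs_of_nonneg (by linarith)] at this
        linarith
      · obtain ⟨t1, ht1, hf1⟩ := H t
        have hbt : dist (γ t0) (γ t) + dist (γ t) (γ t1) = dist (γ t0) (γ t1) := by
          rw [hd, hd, hd, abs_of_nonpos (by linarith), abs_of_nonpos (by linarith),
            abs_of_nonpos (by linarith)]
          ring
        rw [hT.apply_eq_of_between (ρ h) hf0 hbt (by rwa [mem_pointStabiliser.1 hf1]) rfl,
          dist_self]
        linarith
  by_cases hup : ∀ M : ℝ, ∃ t, M ≤ t ∧ h ∈ pointStabiliser ρ (γ t)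
  · exact main γ l hγ hg hup
  by_cases hdown : ∀ M : ℝ, ∃ t, M ≤ t ∧ h ∈ pointStabiliser ρ (γ (-t))
  · exact main (fun t => γ (-t)) (-l) (hγ.comp (IsometryEquiv.neg ℝ).isometry)
      (fun t => by rw [hg]; congr 1; ring) hdown
  push Not at hup hdown
  obtain ⟨M, hM⟩ := hup
  obtain ⟨M', hM'⟩ := hdown
  refine absurd ((Metric.isBounded_Icc (-M') M).subset fun t ht => ⟨?_, ?_⟩) hb
  · by_contra hlt
    exact hM' (-t) (by linarith) (by rwa [neg_neg])
  · by_contra hlt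
    exact hM t (by linarith) ht

/-- One element with an axis and one with a fixed point. If no power of `h` fixes an end of the
axis of `g`, then ping-pong is played by the points that project far from the projection of the
fixed point, and those that project close to it. -/
theorem hasFreeOrFixingPowers_of_axis_of_fixed (hT : IsGeodesicZeroHyperbolic T)
    {ρ : G →* (T ≃ᵢ T)} (hρ : HasStabilisation ρ) {g h : G} {γ : ℝ → T} {l : ℝ} {x : T}
    (hγ : Isometry γ) (hl : 0 < l) (hg : ∀ t, ρ g (γ t) = γ (t + l)) (hx : ρ h x = x) :
    HasFreeOrFixingPowers ρ g h := by
  by_cases hb : ∀ n : ℕ, 1 ≤ n → Bornology.IsBounded {t | h ^ n ∈ pointStabiliser ρ (γ t)}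
  swap
  · push Not at hb
    obtain ⟨n, hn, hb⟩ := hb
    obtain ⟨ξ, h1, h2⟩ := hT.exists_boundary_fixed_of_not_isBounded ρ hγ hg hb
    exact ⟨n, hn, Or.inr (Or.inr ⟨ξ, pow_mem h1 n, h2⟩)⟩
  have hU := hT.isBounded_fixed_of_hasStabilisation hρ hγ h hb
  set c := hT.proj hγ x with hc
  obtain ⟨L, hL0, hL⟩ := hU.subset_ball_lt 0 c
  have hfix : ∀ t, L ≤ |t - c| → ∀ k : ℤ, k ≠ 0 → ρ (h ^ k) (γ t) ≠ γ t := by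
    intro t ht k hk hkt
    have := hL (exists_pow_mem_of_zpow_mem hk (mem_pointStabiliser.2 hkt))
    rw [Metric.mem_ball, Real.dist_eq] at this
    linarith
  have hx' : ∀ k : ℤ, ρ (h ^ k) x = x := fun k => zpow_mem (mem_pointStabiliser.2 hx) k
  have hcL : L ≤ |c + L - c| := by rw [add_sub_cancel_left]; exact le_abs_self L
  have hcL' : L ≤ |c - L - c| := by rw [sub_sub_cancel_left, abs_neg]; exact le_abs_self L
  -- At most one power of `h` exchanges the two sides of `γ c`; a suitable power of `h` has none.
  obtain ⟨M, hM, hflip⟩ : ∃ M : ℕ, 1 ≤ M ∧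
      ∀ k : ℤ, k ≠ 0 → ρ (h ^ (M * k)) (γ (c + L)) ≠ γ (c - L) := by
    by_cases hk0 : ∃ k0 : ℤ, ρ (h ^ k0) (γ (c + L)) = γ (c - L)
    · obtain ⟨k0, hk0⟩ := hk0
      refine ⟨k0.natAbs + 1, by omega, fun k hk hk' => ?_⟩
      have hne : -k0 + (k0.natAbs + 1 : ℕ) * k ≠ 0 := by
        intro e
        have e' : k0 = (k0.natAbs + 1 : ℕ) * k := by linarith
        have := congrArg Int.natAbs e'
        rw [Int.natAbs_mul, Int.natAbs_natCast] at this
        have h1 : 1 ≤ k.natAbs := Int.natAbs_pos.2 hk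
        linarith [Nat.le_mul_of_pos_right (k0.natAbs + 1) h1]
      refine hfix (c + L) hcL _ hne ?_
      rw [zpow_add, _root_.map_mul, IsometryEquiv.mul_apply, hk', ← hk0, zpow_neg,
        _root_.map_inv, IsometryEquiv.inv_apply_self]
    · exact ⟨1, le_rfl, fun k _ hk => hk0 ⟨_, hk⟩⟩
  obtain ⟨K, hK⟩ := exists_nat_gt (2 * L / l)
  rw [div_lt_iff₀ hl] at hK
  have hK0 : 1 ≤ K := by
    rw [Nat.one_le_iff_ne_zero]
    rintro rfl
    rw [Nat.cast_zero, zero_mul] at hK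
    linarith
  have hKM : 2 * L < ((K * M : ℕ) : ℝ) * l := by
    have : (K : ℝ) ≤ (K * M : ℕ) := by exact_mod_cast Nat.le_mul_of_pos_right K hM
    exact hK.trans_le (by gcongr)
  refine ⟨K * M, Nat.mul_pos hK0 hM, Or.inl (nonempty_closure_mulEquiv_freeGroup_of_ping_pong ρ
    (X := {p | L < |hT.proj hγ p - c|}) (Y := {p | |hT.proj hγ p - c| ≤ L})
    ⟨γ (c + L + 1), ?_⟩ ⟨γ c, ?_⟩
    (Set.disjoint_left.2 fun p (h1 : L < |hT.proj hγ p - c|) h2 => not_le.2 h1 h2) ?_ ?_)⟩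
  · change L < |hT.proj hγ (γ (c + L + 1)) - c|
    rw [hT.proj_line hγ, abs_of_pos (by linarith)]
    linarith
  · change |hT.proj hγ (γ c) - c| ≤ L
    rw [hT.proj_line hγ, sub_self, abs_zero]
    exact hL0.le
  · intro k hk p hp
    exact hT.lt_abs_proj_zpow ρ hγ hg hl hKM c hk hp
  · intro k hk p hp
    have e : (h ^ (K * M)) ^ k = h ^ (M * (K * k) : ℤ) := by
      rw [← zpow_natCast, ← zpow_mul]; congr 1; push_cast; ring
    have hKk : (K * k : ℤ) ≠ 0 := mul_ne_zero (by omega) hk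
    have hMk : (M * (K * k) : ℤ) ≠ 0 := mul_ne_zero (by omega) hKk
    rw [e]
    change |_| ≤ L
    by_contra hq
    change L < |hT.proj hγ p - c| at hp
    have right : ∀ q, L < hT.proj hγ q - c →
        dist x (γ (c + L)) + dist (γ (c + L)) q = dist x q := fun q hq =>
      hT.between_of_proj hγ (by linarith) (by linarith)
    have left : ∀ q, L < -(hT.proj hγ q - c) →
        dist x (γ (c - L)) + dist (γ (c - L)) q = dist x q := fun q hq =>
      hT.between_of_proj' hγ (by linarith) (by linarith)
    have hsame : dist x (γ (c + L)) = dist x (γ (c - L)) := by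
      rw [hT.dist_line hγ, hT.dist_line hγ, ← hc, add_sub_cancel_left, sub_sub_cancel_left,
        abs_neg]
    rcases lt_abs.1 hp with hp | hp <;> rcases lt_abs.1 (not_le.1 hq) with hq | hq
    · exact hfix _ hcL _ hMk
        (hT.apply_eq_of_between _ (hx' _) (right p hp) (right _ hq) rfl)
    · exact hflip _ hKk
        (hT.apply_eq_of_between _ (hx' _) (right p hp) (left _ hq) hsame)
    · refine hflip _ (neg_ne_zero.2 hKk) ?_
      rw [← hT.apply_eq_of_between _ (hx' _) (left p hp) (right _ hq) hsame.symm, mul_neg, zpow_neg,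
        _root_.map_inv, IsometryEquiv.inv_apply_self]
    · exact hfix _ hcL' _ hMk
        (hT.apply_eq_of_between _ (hx' _) (left p hp) (left _ hq) rfl)

/-- Any two isometries fall under one of the three cases: each has a fixed point or an axis. -/
theorem hasFreeOrFixingPowers [Nonempty T] (hT : IsGeodesicZeroHyperbolic T)
    {ρ : G →* (T ≃ᵢ T)} (hρ : HasStabilisation ρ) (g h : G) : HasFreeOrFixingPowers ρ g h := by
  by_cases hg : ∃ x, ρ g x = x
  · obtain ⟨x, hx⟩ := hg
    by_cases hh : ∃ y, ρ h y = y
    · obtain ⟨y, hy⟩ := hh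
      exact hT.hasFreeOrFixingPowers_of_fixed_of_fixed ρ hx hy
    · push Not at hh
      obtain ⟨η, m, hη, hm, hm'⟩ := hT.exists_axis (ρ h) hh
      exact (hT.hasFreeOrFixingPowers_of_axis_of_fixed hρ hη hm hm' hx).symm
  · push Not at hg
    obtain ⟨γ, l, hγ, hl, hl'⟩ := hT.exists_axis (ρ g) hg
    by_cases hh : ∃ y, ρ h y = y
    · obtain ⟨y, hy⟩ := hh
      exact hT.hasFreeOrFixingPowers_of_axis_of_fixed hρ hγ hl hl' hy
    · push Not at hh
      obtain ⟨η, m, hη, hm, hm'⟩ := hT.exists_axis (ρ h) hh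
      exact hT.hasFreeOrFixingPowers_of_axis_of_axis ρ hγ hη hl hm hl' hm'

end IsGeodesicZeroHyperbolic

end Actions

/-! ### Real trees -/

section RealTreeIsZeroHyperbolic

variable {T : Type*} [MetricSpace T]

theorem IsGeodesicSegment.exists_param {x y : T} {S : Set T} (h : IsGeodesicSegment x y S) :
    ∃ σ : ℝ → T, σ 0 = x ∧ σ (dist x y) = y ∧ σ '' Set.Icc 0 (dist x y) = S ∧
      ∀ s ∈ Set.Icc 0 (dist x y), ∀ t ∈ Set.Icc 0 (dist x y), dist (σ s) (σ t) = |s - t| := by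
  obtain ⟨a, b, γ, hab, ⟨-, hγ⟩, rfl, rfl, rfl⟩ := h
  have hd : dist (γ a) (γ b) = b - a := by
    rw [hγ a ⟨le_rfl, hab⟩ b ⟨hab, le_rfl⟩, abs_sub_comm, abs_of_nonneg (by linarith)]
  rw [hd]
  refine ⟨fun t => γ (a + t), by simp, by simp, ?_, fun s hs t ht => ?_⟩
  · rw [← Function.comp_def γ, Set.image_comp, Set.image_const_add_Icc]
    simp
  · rw [hγ _ ⟨by linarith [hs.1], by linarith [hs.2]⟩ _ ⟨by linarith [ht.1], by linarith [ht.2]⟩]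
    congr 1; ring

theorem IsGeodesicSegment.between {x y p : T} {S : Set T} (h : IsGeodesicSegment x y S)
    (hp : p ∈ S) : dist x p + dist p y = dist x y := by
  obtain ⟨σ, h0, h1, rfl, hσ⟩ := h.exists_param
  obtain ⟨t, ht, rfl⟩ := hp
  have hD : (0 : ℝ) ≤ dist x y := dist_nonneg
  have e1 := hσ 0 ⟨le_rfl, hD⟩ t ht
  have e2 := hσ t ht _ ⟨hD, le_rfl⟩
  rw [h0, abs_sub_comm, abs_of_nonneg (by linarith [ht.1])] at e1
  rw [h1, abs_sub_comm, abs_of_nonneg (by linarith [ht.2])] at e2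
  linarith

namespace IsRealTree

variable (hT : IsRealTree T)
include hT

theorem mem_segment_of_between {x y p : T} {S : Set T} (h : IsGeodesicSegment x y S)
    (hp : dist x p + dist p y = dist x y) : p ∈ S := by
  obtain ⟨S₁, h₁, -⟩ := hT.existsUnique_segment x p
  obtain ⟨S₂, h₂, -⟩ := hT.existsUnique_segment p y
  have hpS : p ∈ S₁ ∧ p ∈ S₂ := by
    obtain ⟨a, b, γ, hab, -, -, hb, rfl⟩ := h₁
    obtain ⟨c, d, η, hcd, -, hc, -, rfl⟩ := h₂
    exact ⟨⟨b, ⟨hab, le_rfl⟩, hb⟩, ⟨c, ⟨le_rfl, hcd⟩, hc⟩⟩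
  have hu := hT.segment_union x p y S₁ S₂ h₁ h₂ <| Set.Subset.antisymm
    (fun q hq => by
      have e1 := h₁.between hq.1
      have e2 := h₂.between hq.2
      have e3 := dist_triangle x q y
      rw [dist_comm p q] at e2
      exact dist_le_zero.1 (by linarith))
    (Set.singleton_subset_iff.2 hpS)
  rw [(hT.existsUnique_segment x y).unique h hu]
  exact Or.inl hpS.1

/-- The segment between two points, with its parametrisation by the distance from the first. -/
theorem exists_unique_param (x y : T) :
    ∃ σ : ℝ → T, σ 0 = x ∧ (∀ t ∈ Set.Icc 0 (dist x y), dist x (σ t) = t ∧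
      dist (σ t) y = dist x y - t) ∧
      (∀ s ∈ Set.Icc 0 (dist x y), ∀ t ∈ Set.Icc 0 (dist x y), dist (σ s) (σ t) = |s - t|) ∧
      ∀ p, dist x p + dist p y = dist x y → σ (dist x p) = p := by
  obtain ⟨S, hS, -⟩ := hT.existsUnique_segment x y
  obtain ⟨σ, h0, h1, rfl, hσ⟩ := hS.exists_param
  have hD : (0 : ℝ) ≤ dist x y := dist_nonneg
  have e1 : ∀ t ∈ Set.Icc 0 (dist x y), dist x (σ t) = t := fun t ht => by
    conv_lhs => rw [← h0]
    rw [hσ 0 ⟨le_rfl, hD⟩ t ht, abs_sub_comm, sub_zero, abs_of_nonneg ht.1]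
  refine ⟨σ, h0, fun t ht => ⟨e1 t ht, ?_⟩, hσ, fun p hp => ?_⟩
  · linarith [e1 t ht, hS.between ⟨t, ht, rfl⟩]
  · obtain ⟨t, ht, rfl⟩ := hT.mem_segment_of_between hS hp
    rw [e1 t ht]

theorem eq_of_between {x y m m' : T} (h : dist x m + dist m y = dist x y)
    (h' : dist x m' + dist m' y = dist x y) (he : dist x m = dist x m') : m = m' := by
  obtain ⟨σ, -, -, -, hσ⟩ := hT.exists_unique_param x y
  rw [← hσ m h, ← hσ m' h', he]

theorem exists_median (w x y : T) : ∃ m, dist w m + dist m x = dist w x ∧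
    dist w m + dist m y = dist w y ∧ dist x m + dist m y = dist x y := by
  obtain ⟨σ, hσ0, hσd, hσ, hσu⟩ := hT.exists_unique_param w x
  obtain ⟨τ, hτ0, hτd, hτ, hτu⟩ := hT.exists_unique_param w y
  -- The segments `[w, x]` and `[w, y]` agree up to a last parameter `t₀`.
  set E : Set ℝ := {t | 0 ≤ t ∧ t ≤ dist w x ∧ t ≤ dist w y ∧ σ t = τ t} with hE
  have hE0 : (0 : ℝ) ∈ E := ⟨le_rfl, dist_nonneg, dist_nonneg, hσ0.trans hτ0.symm⟩
  have hEb : BddAbove E := ⟨dist w x, fun t ht => ht.2.1⟩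
  set t₀ := sSup E with ht₀
  have h0 : 0 ≤ t₀ := le_csSup hEb hE0
  have hx : t₀ ≤ dist w x := csSup_le ⟨0, hE0⟩ fun t ht => ht.2.1
  have hy : t₀ ≤ dist w y := csSup_le ⟨0, hE0⟩ fun t ht => ht.2.2.1
  have heq : σ t₀ = τ t₀ := by
    refine dist_le_zero.1 (le_of_forall_pos_le_add fun ε hε => ?_)
    obtain ⟨t, ht, htt⟩ := exists_lt_of_lt_csSup ⟨0, hE0⟩ (sub_lt_self t₀ (half_pos hε))
    have htl : t ≤ t₀ := le_csSup hEb ht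
    have d1 := hσ t₀ ⟨h0, hx⟩ t ⟨ht.1, ht.2.1⟩
    have d2 := hτ t ⟨ht.1, ht.2.2.1⟩ t₀ ⟨h0, hy⟩
    have d3 := dist_triangle (σ t₀) (σ t) (τ t₀)
    rw [abs_of_nonneg (by linarith)] at d1
    rw [abs_sub_comm, abs_of_nonneg (by linarith), ← ht.2.2.2] at d2
    linarith
  obtain ⟨m1, m2⟩ := hσd t₀ ⟨h0, hx⟩
  obtain ⟨m3, m4⟩ := hτd t₀ ⟨h0, hy⟩
  rw [← heq] at m4
  set m := σ t₀ with hm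
  obtain ⟨S₁, h₁, -⟩ := hT.existsUnique_segment x m
  obtain ⟨S₂, h₂, -⟩ := hT.existsUnique_segment m y
  have hm1 : m ∈ S₁ := hT.mem_segment_of_between h₁ (by simp)
  have hm2 : m ∈ S₂ := hT.mem_segment_of_between h₂ (by simp)
  have hinter : S₁ ∩ S₂ = {m} := by
    refine Set.Subset.antisymm (fun p hp => ?_) (Set.singleton_subset_iff.2 ⟨hm1, hm2⟩)
    have e1 := h₁.between hp.1
    have e2 := h₂.between hp.2
    rw [dist_comm x p, dist_comm x m, dist_comm p m] at e1
    have p1 := dist_triangle w p x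
    have p2 := dist_triangle w m p
    have p3 := dist_triangle w p y
    have q1 : dist w p = t₀ + dist m p := by linarith
    have s1 := hσu p (by linarith)
    have s2 := hτu p (by linarith)
    have d1 : 0 ≤ dist p x := dist_nonneg
    have d2 : 0 ≤ dist p y := dist_nonneg
    have := le_csSup hEb (a := dist w p)
      ⟨dist_nonneg, by linarith, by linarith, s1.trans s2.symm⟩
    rw [← ht₀] at this
    exact (dist_le_zero.1 (by linarith : dist m p ≤ 0)).symm
  have hu := hT.segment_union x m y S₁ S₂ h₁ h₂ hinter
  exact ⟨m, by linarith, by linarith, hu.between (Or.inl hm1)⟩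

/-- A real tree satisfies the four-point condition: with respect to the base point `w`, two
segments branching off `[w, z]` at different points have the nearer branch point in common. -/
theorem isGeodesicZeroHyperbolic : IsGeodesicZeroHyperbolic T where
  four_point := by
    have key : ∀ x y z w m n : T, dist w m + dist m x = dist w x → dist w m + dist m z = dist w z →
        dist x m + dist m z = dist x z → dist w n + dist n y = dist w y →
        dist w n + dist n z = dist w z → dist w m ≤ dist w n →
        dist x y + dist z w ≤ dist x z + dist y w := by
      intro x y z w m n h1 h2 h3 h4 h5 hmn
      obtain ⟨σ, -, hσd, -, -⟩ := hT.exists_unique_param w n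
      obtain ⟨q1, q2⟩ := hσd (dist w m) ⟨dist_nonneg, hmn⟩
      have t1 := dist_triangle (σ (dist w m)) n z
      have t2 := dist_triangle w (σ (dist w m)) z
      have e : σ (dist w m) = m := hT.eq_of_between (x := w) (y := z) (by linarith) h2 q1
      rw [e] at q2
      have t3 := dist_triangle m n y
      have t4 := dist_triangle x m y
      rw [dist_comm x m] at t4 h3
      rw [dist_comm z w, dist_comm y w]
      linarith
    intro x y z w
    obtain ⟨m, h1, h2, h3⟩ := hT.exists_median w x z
    obtain ⟨n, h4, h5, h6⟩ := hT.exists_median w y z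
    rcases le_total (dist w m) (dist w n) with h | h
    · exact le_max_of_le_left (key x y z w m n h1 h2 h3 h4 h5 h)
    · refine le_max_of_le_right ?_
      have := key y x z w n m h4 h5 h6 h1 h2 h
      rw [dist_comm y x] at this
      linarith
  exists_between x y t h0 h1 := by
    obtain ⟨σ, -, hσ, -, -⟩ := hT.exists_unique_param x y
    exact ⟨σ t, hσ t ⟨h0, h1⟩⟩

end IsRealTree

end RealTreeIsZeroHyperbolic

/-! ### Simplicial trees -/

section RootedTrees

variable {V : Type*}

/-- A rooting of a graph: a depth function with a single vertex of depth zero, and a map sending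
each vertex to its parent, which lies one level higher, such that every edge joins a vertex to its
parent. The root is its own parent. -/
structure Rooting (Γ : SimpleGraph V) where
  depth : V → ℕ
  par : V → V
  isCell_par : ∀ u, Γ.IsCell u (par u)
  eq_par_of_adj : ∀ {u v}, Γ.Adj u v → v = par u ∨ u = par v
  depth_par : ∀ u, depth (par u) = depth u - 1
  eq_of_depth_eq_zero : ∀ {u v}, depth u = 0 → depth v = 0 → u = v

theorem SimpleGraph.IsTree.nonempty_rooting {Γ : SimpleGraph V} (hΓ : Γ.IsTree) :
    Nonempty (Rooting Γ) := by
  classical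
  obtain ⟨r⟩ := hΓ.connected.nonempty
  choose p hp hpl using fun u => hΓ.connected.exists_path_of_dist r u
  have hr : ∀ u, Γ.dist r u = 0 ↔ r = u := fun u => hΓ.connected.dist_eq_zero_iff
  have hclose : ∀ u w, Γ.Adj u w → Γ.dist r u = Γ.dist r w + 1 → w = (p u).penultimate := by
    intro u w huw hd
    refine hΓ.isAcyclic.eq_penultimate_of_adj_end (hp u) huw ?_
    refine hΓ.isAcyclic.mem_support_of_ne_mem_support_of_adj_of_isPath (hp u) (hp w) huw
      fun hmem => ?_
    have h1 := Γ.dist_le ((p w).takeUntil u hmem)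
    have h2 := (p w).length_takeUntil_le_length hmem
    rw [hpl w] at h2
    omega
  have hpar : ∀ u, u ≠ r → Γ.Adj u (p u).penultimate ∧
      Γ.dist r u = Γ.dist r (p u).penultimate + 1 := by
    intro u hu
    have hnil : ¬ (p u).Nil := fun h => hu h.eq.symm
    have hadj := (p u).adj_penultimate hnil
    refine ⟨hadj.symm, ?_⟩
    have h1 := Γ.dist_le (p u).dropLast
    have h2 : (p u).dropLast.length = (p u).length - 1 := by simp
    have h3 := hΓ.dist_eq_dist_add_one_of_adj r hadj
    rw [h2, hpl u] at h1
    omega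
  refine ⟨⟨Γ.dist r, fun u => if u = r then r else (p u).penultimate, fun u => ?_,
    fun {u v} huv => ?_, fun u => ?_, fun {u v} hu hv => ?_⟩⟩
  · by_cases hu : u = r
    · rw [if_pos hu]; exact Or.inl hu
    · rw [if_neg hu]; exact Or.inr (hpar u hu).1
  · rcases hΓ.dist_eq_dist_add_one_of_adj r huv with h | h
    · left
      rw [if_neg (by rintro rfl; simp at h)]
      exact hclose u v huv h
    · right
      rw [if_neg (by rintro rfl; simp at h)]
      exact hclose v u huv.symm h
  · by_cases hu : u = r
    · rw [if_pos hu, hu]; simp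
    · rw [if_neg hu]
      have := (hpar u hu).2
      omega
  · rw [← (hr u).1 hu, ← (hr v).1 hv]

namespace Rooting

variable {Γ : SimpleGraph V} (R : Rooting Γ)

/-- `R.Anc v u`: the vertex `v` is an ancestor of `u`, possibly `u` itself. -/
def Anc (v u : V) : Prop := ∃ k : ℕ, R.par^[k] u = v

theorem anc_self (u : V) : R.Anc u u := ⟨0, rfl⟩

theorem Anc.trans {R : Rooting Γ} {u v w : V} (h : R.Anc u v) (h' : R.Anc v w) : R.Anc u w := by
  obtain ⟨k, rfl⟩ := h
  obtain ⟨j, rfl⟩ := h'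
  exact ⟨k + j, Function.iterate_add_apply _ _ _ _⟩

theorem anc_par (u : V) : R.Anc (R.par u) u := ⟨1, rfl⟩

theorem Anc.eq_or_anc_par {R : Rooting Γ} {v u : V} (h : R.Anc v u) : v = u ∨ R.Anc v (R.par u) := by
  obtain ⟨k, rfl⟩ := h
  cases k with
  | zero => exact Or.inl rfl
  | succ k => exact Or.inr ⟨k, rfl⟩

theorem Anc.total {R : Rooting Γ} {v v' u : V} (h : R.Anc v u) (h' : R.Anc v' u) :
    R.Anc v v' ∨ R.Anc v' v := by
  obtain ⟨k, rfl⟩ := h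
  obtain ⟨j, rfl⟩ := h'
  rcases le_total k j with hkj | hkj
  · obtain ⟨d, rfl⟩ := Nat.exists_eq_add_of_le' hkj
    exact Or.inr ⟨d, (Function.iterate_add_apply _ _ _ _).symm⟩
  · obtain ⟨d, rfl⟩ := Nat.exists_eq_add_of_le' hkj
    exact Or.inl ⟨d, (Function.iterate_add_apply _ _ _ _).symm⟩

theorem depth_iterate (k : ℕ) (u : V) : R.depth (R.par^[k] u) = R.depth u - k := by
  induction k with
  | zero => rfl
  | succ k ih => rw [Function.iterate_succ_apply', R.depth_par, ih]; omega

theorem Anc.eq_of_depth_le {R : Rooting Γ} {v u : V} (h : R.Anc v u)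
    (hd : R.depth u ≤ R.depth v) : v = u := by
  obtain ⟨k, rfl⟩ := h
  rw [R.depth_iterate] at hd
  rcases Nat.eq_zero_or_pos k with rfl | hk
  · rfl
  · exact R.eq_of_depth_eq_zero (by rw [R.depth_iterate]; omega) (by omega)

theorem Anc.depth_le {R : Rooting Γ} {v u : V} (h : R.Anc v u) : R.depth v ≤ R.depth u := by
  obtain ⟨k, rfl⟩ := h
  rw [R.depth_iterate]
  exact Nat.sub_le _ _

theorem Anc.antisymm {R : Rooting Γ} {v u : V} (h : R.Anc v u) (h' : R.Anc u v) : v = u :=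
  h.eq_of_depth_le h'.depth_le

end Rooting

end RootedTrees

/-- The four-point condition follows from the ultrametric inequality for Gromov products based at
one point. -/
theorem min_add_le_of_ultrametric {α : Type*} (m : α → α → ℝ) (hs : ∀ p q, m p q = m q p)
    (hu : ∀ p q s, min (m p q) (m q s) ≤ m p s) (x y z w : α) :
    min (m x z + m y w) (m x w + m y z) ≤ m x y + m z w := by
  have u1 := hu x z y
  have u2 := hu x w y
  have u3 := hu z x w
  have u4 := hu z y w
  have u5 := hu x y z
  have u6 := hu x w z
  have u7 := hu y x z
  have u8 := hu y w z
  have u9 := hu x y w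
  have u10 := hu x z w
  have u11 := hu y x w
  have u12 := hu y z w
  rw [hs z y] at u1
  rw [hs w y] at u2
  rw [hs z x] at u3
  rw [hs z y] at u4
  rw [hs w z] at u6 u8
  rw [hs y x] at u7 u11
  clear hs hu
  generalize m x y = a at *
  generalize m x z = b at *
  generalize m x w = c at *
  generalize m y z = d at *
  generalize m y w = e at *
  generalize m z w = f at *
  simp only [min_le_iff] at *
  by_contra! hcon
  grind

namespace Realisation

variable {V : Type*} {Γ : SimpleGraph V} {hΓ : Γ.Connected}

theorem coord_le_one (x : Realisation Γ hΓ) (u : V) : x.coord u ≤ 1 := by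
  obtain ⟨a, b, hab, hx⟩ := x.supported
  by_cases hne : a = b
  · subst hne
    by_cases hu : u = a
    · subst hu; exact (OnCell.eq_one hx).le
    · rw [OnCell.coord_eq_zero hx hu hu]; exact zero_le_one
  · have := OnCell.sum hx hne
    by_cases hu : u = a
    · subst hu; linarith [x.nonneg b]
    · by_cases hu' : u = b
      · subst hu'; linarith [x.nonneg a]
      · rw [OnCell.coord_eq_zero hx hu hu']; exact zero_le_one

/-- A point of a closed cell with prescribed first coordinate. -/
theorem exists_onCell_coord_eq {u v : V} (huv : Γ.Adj u v) {a : ℝ} (h0 : 0 ≤ a) (h1 : a ≤ 1) :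
    ∃ z : Realisation Γ hΓ, z.OnCell u v ∧ z.coord u = a := by
  classical
  have hne : u ≠ v := huv.ne
  have hc : ∀ w, (Finsupp.single u a + Finsupp.single v (1 - a)) w =
      (if u = w then a else 0) + if v = w then 1 - a else 0 := fun w => by
    rw [Finsupp.add_apply, Finsupp.single_apply, Finsupp.single_apply]
  have hs : ((Finsupp.single u a + Finsupp.single v (1 - a)).support : Set V) ⊆ {u, v} := by
    intro w hw
    by_contra hne
    simp only [Set.mem_insert_iff, Set.mem_singleton_iff, not_or] at hne
    refine Finsupp.mem_support_iff.1 (Finset.mem_coe.1 hw) ?_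
    rw [hc, if_neg (Ne.symm hne.1), if_neg (Ne.symm hne.2), add_zero]
  refine ⟨⟨Finsupp.single u a + Finsupp.single v (1 - a), fun w => ?_, ?_, u, v, Or.inr huv, hs⟩,
    hs, ?_⟩
  · rw [hc]
    refine add_nonneg ?_ ?_ <;> split_ifs <;> linarith
  · rw [Finsupp.sum_add_index' (fun _ => rfl) (fun _ _ _ => rfl), Finsupp.sum_single_index rfl,
      Finsupp.sum_single_index rfl]
    ring
  · change (Finsupp.single u a + Finsupp.single v (1 - a)) u = a
    rw [hc, if_pos rfl, if_neg hne.symm, add_zero]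

theorem PathLength.exists_between {x y : Realisation Γ hΓ} {L : ℝ} (p : PathLength x y L) :
    ∀ t, 0 ≤ t → t ≤ L → ∃ z, PathLength x z t ∧ PathLength z y (L - t) := by
  induction p with
  | nil x =>
    intro t h0 h1
    obtain rfl := le_antisymm h1 h0
    exact ⟨x, .nil x, by rw [sub_zero]; exact .nil x⟩
  | @cons x y z L u v huv hx hy p ih =>
    intro t h0 h1
    set d := |x.coord u - y.coord u| with hd
    by_cases htd : d ≤ t
    · obtain ⟨w, hw1, hw2⟩ := ih (t - d) (by linarith) (by linarith)
      refine ⟨w, ?_, ?_⟩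
      · have := PathLength.cons u v huv hx hy hw1
        rwa [← hd, add_sub_cancel] at this
      · rwa [show d + L - t = L - (t - d) by ring]
    · push Not at htd
      have hd0 : 0 < d := h0.trans_lt htd
      rcases huv with rfl | huv
      · rw [hd, OnCell.eq_one hx, OnCell.eq_one hy, sub_self, abs_zero] at hd0
        exact absurd hd0 (lt_irrefl _)
      -- The point of the cell at proportion `t / d` from `x` to `y`.
      set s := t / d with hs
      have hs0 : 0 ≤ s := div_nonneg h0 hd0.le
      have hs1 : s ≤ 1 := (div_le_one hd0).2 htd.le
      have hsd : s * d = t := div_mul_cancel₀ _ hd0.ne'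
      have hx1 := x.coord_le_one u
      have hy1 := y.coord_le_one u
      have hx0 := x.nonneg u
      have hy0 := y.nonneg u
      obtain ⟨w, hw, hwu⟩ := exists_onCell_coord_eq (hΓ := hΓ) huv
        (a := (1 - s) * x.coord u + s * y.coord u)
        (add_nonneg (mul_nonneg (by linarith) hx0) (mul_nonneg hs0 hy0)) (by nlinarith)
      refine ⟨w, ?_, ?_⟩
      · have := PathLength.cons u v (Or.inr huv) hx hw (.nil w)
        rwa [hwu, show x.coord u - ((1 - s) * x.coord u + s * y.coord u) =
          s * (x.coord u - y.coord u) by ring, abs_mul, abs_of_nonneg hs0, ← hd, hsd,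
          add_zero] at this
      · have := PathLength.cons u v (Or.inr huv) hw hy p
        rwa [hwu, show (1 - s) * x.coord u + s * y.coord u - y.coord u =
          (1 - s) * (x.coord u - y.coord u) by ring, abs_mul, abs_of_nonneg (by linarith), ← hd,
          sub_mul, one_mul, hsd, show d - t + L = d + L - t by ring] at this

theorem dist_le_of_pathLength {x y : Realisation Γ hΓ} {L : ℝ} (p : PathLength x y L) :
    dist x y ≤ L :=
  csInf_le (s := {L | PathLength x y L}) ⟨0, fun _ q => PathLength.nonneg q⟩ p

section Rooted

variable (R : Rooting Γ)

open Classical in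
/-- The total weight that the barycentric coordinates of `x` give to the descendants of `v`. It
measures how far the segment from the root to `x` gets along the edge above `v`, and the family of
these numbers embeds the realisation isometrically into `ℓ¹(V)`. -/
noncomputable def weight (x : Realisation Γ hΓ) (v : V) : ℝ :=
  x.coord.sum fun w a => if R.Anc v w then a else 0

theorem exists_onCell_par (x : Realisation Γ hΓ) : ∃ u, x.OnCell u (R.par u) := by
  obtain ⟨a, b, hab, hx⟩ := x.supported
  rcases hab with rfl | hab
  · exact ⟨a, hx.trans (by simp)⟩
  · rcases R.eq_par_of_adj hab with rfl | rfl
    · exact ⟨a, hx⟩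
    · exact ⟨b, OnCell.symm hx⟩

open Classical in
theorem weight_eq {x : Realisation Γ hΓ} {u : V} (hx : x.OnCell u (R.par u)) (v : V) :
    weight R x v = if v = u then x.coord u else if R.Anc v u then 1 else 0 := by
  have hs : x.coord.support ⊆ ({u, R.par u} : Finset V) := fun w hw => by
    have := hx (Finset.mem_coe.2 hw)
    simpa using this
  rw [weight, Finsupp.sum_of_support_subset _ hs _ (by simp)]
  by_cases hu : u = R.par u
  · have hone : x.coord u = 1 := by
      rw [← hu] at hx
      exact hx.eq_one
    rw [← hu, Finset.pair_eq_singleton, Finset.sum_singleton, hone]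
    by_cases hv : v = u
    · rw [if_pos hv, if_pos (hv ▸ R.anc_self v)]
    · rw [if_neg hv]
  · have hsum := hx.sum hu
    rw [Finset.sum_pair hu]
    by_cases hv : v = u
    · subst hv
      rw [if_pos (R.anc_self v), if_pos rfl,
        if_neg fun h => hu (h.antisymm (R.anc_par v)), add_zero]
    · rw [if_neg hv]
      by_cases ha : R.Anc v u
      · rw [if_pos ha, if_pos ha, if_pos (ha.eq_or_anc_par.resolve_left hv), hsum]
      · rw [if_neg ha, if_neg ha, if_neg fun h => ha (h.trans (R.anc_par u)), add_zero]

theorem weight_nonneg (x : Realisation Γ hΓ) (v : V) : 0 ≤ weight R x v := by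
  classical
  obtain ⟨u, hu⟩ := exists_onCell_par R x
  rw [weight_eq R hu]
  split_ifs
  exacts [x.nonneg u, zero_le_one, le_rfl]

theorem weight_le_one (x : Realisation Γ hΓ) (v : V) : weight R x v ≤ 1 := by
  classical
  obtain ⟨u, hu⟩ := exists_onCell_par R x
  rw [weight_eq R hu]
  split_ifs
  exacts [x.coord_le_one u, le_rfl, zero_le_one]

theorem anc_of_weight_pos {x : Realisation Γ hΓ} {u v : V} (hx : x.OnCell u (R.par u))
    (h : 0 < weight R x v) : R.Anc v u := by
  classical
  by_contra ha
  have hne : v ≠ u := fun e => ha (e ▸ R.anc_self v)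
  rw [weight_eq R hx, if_neg hne, if_neg ha] at h
  exact lt_irrefl _ h

theorem weight_eq_one {x : Realisation Γ hΓ} {v v' : V} (h : 0 < weight R x v)
    (hv : R.Anc v' v) (hne : v' ≠ v) : weight R x v' = 1 := by
  classical
  obtain ⟨u, hu⟩ := exists_onCell_par R x
  have ha := anc_of_weight_pos R hu h
  rw [weight_eq R hu, if_neg, if_pos (hv.trans ha)]
  rintro rfl
  exact hne (hv.antisymm ha)

theorem anc_or_anc_of_weight_pos {x : Realisation Γ hΓ} {v v' : V} (h : 0 < weight R x v)
    (h' : 0 < weight R x v') : R.Anc v v' ∨ R.Anc v' v := by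
  obtain ⟨u, hu⟩ := exists_onCell_par R x
  exact (anc_of_weight_pos R hu h).total (anc_of_weight_pos R hu h')

open Classical in
theorem weight_sub_weight {x y : Realisation Γ hΓ} {u : V} (hx : x.OnCell u (R.par u))
    (hy : y.OnCell u (R.par u)) (v : V) :
    weight R x v - weight R y v = if v = u then x.coord u - y.coord u else 0 := by
  rw [weight_eq R hx, weight_eq R hy]
  split_ifs <;> ring

theorem sum_abs_weight_sub_le_of_onCell {x y : Realisation Γ hΓ} {u : V}
    (hx : x.OnCell u (R.par u)) (hy : y.OnCell u (R.par u)) (B : Finset V) :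
    ∑ v ∈ B, |weight R x v - weight R y v| ≤ |x.coord u - y.coord u| := by
  classical
  simp_rw [weight_sub_weight R hx hy, apply_ite abs, abs_zero]
  rw [Finset.sum_ite_eq']
  split_ifs
  exacts [le_rfl, abs_nonneg _]

theorem PathLength.sum_abs_weight_sub_le {x y : Realisation Γ hΓ} {L : ℝ} (p : PathLength x y L)
    (B : Finset V) : ∑ v ∈ B, |weight R x v - weight R y v| ≤ L := by
  induction p with
  | nil x => simp
  | @cons x y z L u v huv hx hy p ih =>
    have h1 : ∑ w ∈ B, |weight R x w - weight R z w| ≤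
        ∑ w ∈ B, |weight R x w - weight R y w| + ∑ w ∈ B, |weight R y w - weight R z w| := by
      rw [← Finset.sum_add_distrib]
      exact Finset.sum_le_sum fun w _ => abs_sub_le _ _ _
    have h2 : ∑ w ∈ B, |weight R x w - weight R y w| ≤ |x.coord u - y.coord u| := by
      rcases huv with rfl | huv
      · exact sum_abs_weight_sub_le_of_onCell R (hx.trans (by simp)) (hy.trans (by simp)) B
      · rcases R.eq_par_of_adj huv with rfl | rfl
        · exact sum_abs_weight_sub_le_of_onCell R hx hy B
        · exact (sum_abs_weight_sub_le_of_onCell R hx.symm hy.symm B).trans (hx.abs_le hy v)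
    linarith

/-- A path that realises the `ℓ¹`-distance of the weights: as long as the two points lie below
different vertices, the one below the deeper vertex moves up to the next vertex. -/
theorem exists_pathLength_sum_aux (n : ℕ) : ∀ (x y : Realisation Γ hΓ) (u w : V),
    R.depth u + R.depth w = n → x.OnCell u (R.par u) → y.OnCell w (R.par w) →
    ∃ B₀ : Finset V, ∀ B, B₀ ⊆ B → PathLength x y (∑ v ∈ B, |weight R x v - weight R y v|) := by
  classical
  induction n using Nat.strong_induction_on with
  | _ n ih =>
    have step : ∀ (x y : Realisation Γ hΓ) (u w : V), R.depth u + R.depth w = n →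
        x.OnCell u (R.par u) → y.OnCell w (R.par w) → u ≠ w → R.depth w ≤ R.depth u →
        ∃ B₀ : Finset V, ∀ B, B₀ ⊆ B →
          PathLength x y (∑ v ∈ B, |weight R x v - weight R y v|) := by
      intro x y u w hn hx hy huw hd
      have hu0 : R.depth u ≠ 0 := fun h => huw (R.eq_of_depth_eq_zero h (by omega))
      have hpu := R.depth_par u
      -- Walk from `x` up to the parent of `u`.
      set x' : Realisation Γ hΓ := vertex (R.par u) with hx'
      have hx1 : x'.OnCell u (R.par u) := (vertex_onCell_left _ _).symm
      have hx2 : x'.OnCell (R.par u) (R.par (R.par u)) := vertex_onCell_left _ _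
      obtain ⟨B₀, hB₀⟩ := ih (R.depth (R.par u) + R.depth w) (by omega) x' y (R.par u) w rfl hx2 hy
      have hx'u : x'.coord u = 0 := by
        refine Finsupp.single_eq_of_ne fun e => ?_
        have := congrArg R.depth e
        omega
      have hyu : weight R y u = 0 := by
        rw [weight_eq R hy, if_neg huw, if_neg fun h => huw (h.eq_of_depth_le hd)]
      refine ⟨insert u B₀, fun B hB => ?_⟩
      have huB : u ∈ B := hB (Finset.mem_insert_self _ _)
      have hpt : ∀ v, |weight R x v - weight R y v| =
          (if v = u then |x.coord u - x'.coord u| else 0) + |weight R x' v - weight R y v| := by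
        intro v
        have h1 := weight_sub_weight R hx hx1 v
        by_cases hv : v = u
        · subst hv
          rw [if_pos rfl] at h1 ⊢
          have h2 : weight R x' v = 0 := by rw [weight_eq R hx1, if_pos rfl, hx'u]
          rw [← h1, hyu, h2]
          simp
        · rw [if_neg hv] at h1 ⊢
          rw [sub_eq_zero.1 h1, zero_add]
      have := PathLength.cons u (R.par u) (R.isCell_par u) hx hx1
        (hB₀ B ((Finset.subset_insert _ _).trans hB))
      rwa [Finset.sum_congr rfl fun v _ => hpt v, Finset.sum_add_distrib, Finset.sum_ite_eq',
        if_pos huB]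
    intro x y u w hn hx hy
    by_cases huw : u = w
    · subst huw
      refine ⟨{u}, fun B hB => ?_⟩
      have huB : u ∈ B := hB (Finset.mem_singleton_self _)
      have := PathLength.cons u (R.par u) (R.isCell_par u) hx hy (.nil y)
      simp_rw [weight_sub_weight R hx hy, apply_ite abs, abs_zero]
      rwa [Finset.sum_ite_eq', if_pos huB, ← add_zero |_|]
    · rcases le_total (R.depth w) (R.depth u) with hd | hd
      · exact step x y u w hn hx hy huw hd
      · obtain ⟨B₀, hB₀⟩ := step y x w u (by omega) hy hx (Ne.symm huw) hd
        refine ⟨B₀, fun B hB => ?_⟩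
        simp_rw [abs_sub_comm (weight R x _)]
        exact (hB₀ B hB).symm

theorem exists_pathLength_sum (x y : Realisation Γ hΓ) : ∃ B₀ : Finset V, ∀ B, B₀ ⊆ B →
    PathLength x y (∑ v ∈ B, |weight R x v - weight R y v|) := by
  obtain ⟨u, hu⟩ := exists_onCell_par R x
  obtain ⟨w, hw⟩ := exists_onCell_par R y
  exact exists_pathLength_sum_aux R _ x y u w rfl hu hw

theorem dist_eq_of_pathLength_sum {x y : Realisation Γ hΓ} {B : Finset V}
    (h : PathLength x y (∑ v ∈ B, |weight R x v - weight R y v|)) :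
    dist x y = ∑ v ∈ B, |weight R x v - weight R y v| :=
  le_antisymm (dist_le_of_pathLength h)
    (le_csInf (s := {L | PathLength x y L}) (exists_pathLength x y) fun _ p =>
      PathLength.sum_abs_weight_sub_le R p B)

/-- The weights embed the realisation isometrically into `ℓ¹(V)`. -/
theorem eventually_dist_eq_sum (x y : Realisation Γ hΓ) : ∀ᶠ B : Finset V in atTop,
    dist x y = ∑ v ∈ B, |weight R x v - weight R y v| := by
  obtain ⟨B₀, hB₀⟩ := exists_pathLength_sum R x y
  filter_upwards [eventually_ge_atTop B₀] with B hB
  exact dist_eq_of_pathLength_sum R (hB₀ B hB)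

/-- The overlaps of the segments from the root to `x`, `y`, `z` satisfy the ultrametric
inequality, since the overlaps of `[r, x]` and of `[r, z]` with `[r, y]` are nested. -/
theorem min_sum_min_weight_le (B : Finset V) (x y z : Realisation Γ hΓ) :
    min (∑ v ∈ B, min (weight R x v) (weight R y v)) (∑ v ∈ B, min (weight R y v) (weight R z v)) ≤
      ∑ v ∈ B, min (weight R x v) (weight R z v) := by
  have key : ∀ x y z : Realisation Γ hΓ, ∀ v w, weight R z v < min (weight R x v) (weight R y v) →
      weight R x w < min (weight R y w) (weight R z w) → ¬ R.Anc v w := by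
    intro x y z v w hv hw ha
    have h1 : 0 < weight R z w :=
      (weight_nonneg R x w).trans_lt (hw.trans_le (min_le_right _ _))
    have hne : v ≠ w := by
      rintro rfl
      have := hv.trans_le (min_le_left _ _)
      have := hw.trans_le (min_le_right _ _)
      linarith
    have h2 := weight_eq_one R h1 ha hne
    have h3 := hv.trans_le (min_le_left _ _)
    linarith [weight_le_one R x v]
  by_cases hcase : ∀ v, min (weight R x v) (weight R y v) ≤ weight R z v
  · exact min_le_of_left_le (Finset.sum_le_sum fun v _ => le_min (min_le_left _ _) (hcase v))
  · push Not at hcase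
    obtain ⟨v, hv⟩ := hcase
    refine min_le_of_right_le (Finset.sum_le_sum fun w _ => le_min ?_ (min_le_right _ _))
    by_contra! hw
    have hyv : 0 < weight R y v :=
      (weight_nonneg R z v).trans_lt (hv.trans_le (min_le_right _ _))
    have hyw : 0 < weight R y w :=
      (weight_nonneg R x w).trans_lt (hw.trans_le (min_le_left _ _))
    rcases anc_or_anc_of_weight_pos R hyv hyw with ha | ha
    · exact key x y z v w hv hw ha
    · exact key z y x w v (by rwa [min_comm]) (by rwa [min_comm]) ha

end Rooted

theorem isGeodesicZeroHyperbolic (hT : Γ.IsTree) :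
    IsGeodesicZeroHyperbolic (Realisation Γ hΓ) := by
  obtain ⟨R⟩ := hT.nonempty_rooting
  refine ⟨fun x y z w => ?_, fun x y t h0 h1 => ?_⟩
  · obtain ⟨B, h1, h2, h3, h4, h5, h6⟩ := ((eventually_dist_eq_sum R x y).and <|
      (eventually_dist_eq_sum R z w).and <| (eventually_dist_eq_sum R x z).and <|
      (eventually_dist_eq_sum R y w).and <| (eventually_dist_eq_sum R x w).and
      (eventually_dist_eq_sum R y z)).exists
    set N : Realisation Γ hΓ → ℝ := fun p => ∑ v ∈ B, weight R p v with hN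
    set m : Realisation Γ hΓ → Realisation Γ hΓ → ℝ :=
      fun p q => ∑ v ∈ B, min (weight R p v) (weight R q v) with hm
    have hD : ∀ p q : Realisation Γ hΓ,
        ∑ v ∈ B, |weight R p v - weight R q v| = N p + N q - 2 * m p q := by
      intro p q
      simp only [hN, hm]
      rw [Finset.mul_sum, ← Finset.sum_add_distrib, ← Finset.sum_sub_distrib]
      refine Finset.sum_congr rfl fun v _ => ?_
      rcases le_total (weight R p v) (weight R q v) with h | h
      · rw [min_eq_left h, abs_of_nonpos (by linarith)]; ring
      · rw [min_eq_right h, abs_of_nonneg (by linarith)]; ring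
    have h4p := min_add_le_of_ultrametric m (fun p q => by simp only [hm, min_comm])
      (min_sum_min_weight_le R B) x y z w
    rw [h1, h2, h3, h4, h5, h6]
    simp only [hD]
    rw [le_max_iff]
    rcases min_le_iff.1 h4p with h | h
    · left; linarith
    · right; linarith
  · obtain ⟨B, hB⟩ := exists_pathLength_sum R x y
    have hp := hB B subset_rfl
    rw [← dist_eq_of_pathLength_sum R hp] at hp
    obtain ⟨z, hz1, hz2⟩ := hp.exists_between t h0 h1
    have d1 := dist_le_of_pathLength hz1
    have d2 := dist_le_of_pathLength hz2
    have d3 := dist_triangle x z y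
    exact ⟨z, by linarith, by linarith⟩

end Realisation

/-! ### The power alternative -/

theorem PowerAlternative.exists_pow_of_mem {G : Type*} [Group G] {H : Subgroup G}
    (hH : PowerAlternative H) {a b : G} (ha : a ∈ H) (hb : b ∈ H) : ∃ n : ℕ, 1 ≤ n ∧
    (Commute (a ^ n) (b ^ n) ∨
      Nonempty (Subgroup.closure ({a ^ n, b ^ n} : Set G) ≃* FreeGroup (Fin 2))) := by
  obtain ⟨n, hn, h⟩ := hH ⟨a, ha⟩ ⟨b, hb⟩
  refine ⟨n, hn, h.imp (fun h => ?_) fun ⟨e⟩ => ?_⟩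
  · exact h.map H.subtype
  · have hmap : (Subgroup.closure ({(⟨a, ha⟩ : H) ^ n, (⟨b, hb⟩ : H) ^ n} : Set H)).map H.subtype =
        Subgroup.closure {a ^ n, b ^ n} := by
      rw [MonoidHom.map_closure, Set.image_pair]
      rfl
    exact ⟨(MulEquiv.subgroupCongr hmap).symm.trans
      ((Subgroup.equivMapOfInjective _ _ H.subtype_injective).symm.trans e)⟩

/-- If the powers of any two elements generate a free group or lie in a subgroup with the power
alternative, then the whole group satisfies it. -/
theorem powerAlternative_of_forall_pow {G : Type*} [Group G]
    (h : ∀ g h : G, ∃ n : ℕ, 1 ≤ n ∧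
      (Nonempty (Subgroup.closure ({g ^ n, h ^ n} : Set G) ≃* FreeGroup (Fin 2)) ∨
        ∃ H : Subgroup G, PowerAlternative H ∧ g ^ n ∈ H ∧ h ^ n ∈ H)) :
    PowerAlternative G := by
  intro a b
  obtain ⟨n, hn, hfree | ⟨H, hH, ha, hb⟩⟩ := h a b
  · exact ⟨n, hn, Or.inr hfree⟩
  · obtain ⟨m, hm, h⟩ := hH.exists_pow_of_mem ha hb
    rw [← pow_mul, ← pow_mul] at h
    exact ⟨n * m, Nat.mul_pos hn hm, h⟩

/-- An automorphism that fixes a point of the realisation may exchange the ends of the edge that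
carries this point, but its square does not. -/
theorem Realisation.apply_apply_eq_of_map_eq {V : Type*} {Γ : SimpleGraph V} {hΓ : Γ.Connected}
    {φ : Γ ≃g Γ} {x : Realisation Γ hΓ} (h : Realisation.map φ x = x) {u : V}
    (hu : u ∈ x.coord.support) : φ (φ u) = u := by
  have hsupp : ∀ w ∈ x.coord.support, φ w ∈ x.coord.support := by
    intro w hw
    rw [Finsupp.mem_support_iff] at hw ⊢
    rw [← h, Realisation.map_coord, RelIso.symm_apply_apply]
    exact hw
  obtain ⟨a, b, -, hab⟩ := x.supported
  have h0 := hab hu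
  have h1 := hab (hsupp u hu)
  have h2 := hab (hsupp _ (hsupp u hu))
  simp only [Set.mem_insert_iff, Set.mem_singleton_iff] at h0 h1 h2
  by_cases he : φ u = u
  · rw [he, he]
  · have he' : φ (φ u) ≠ φ u := fun e => he (φ.injective e)
    clear hsupp hab
    grind

theorem Realisation.exists_sq_mem_vertexStabiliser {V G : Type*} [Group G] {Γ : SimpleGraph V}
    {hΓ : Γ.Connected} (φ : G →* (Γ ≃g Γ)) (x : Realisation Γ hΓ) :
    ∃ v : V, ∀ g ∈ pointStabiliser ((Realisation.autHom Γ hΓ).comp φ) x,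
      g ^ 2 ∈ vertexStabiliser φ v := by
  have hne : x.coord.support.Nonempty := by
    rw [Finsupp.support_nonempty_iff]
    intro h
    have := x.sum_eq_one
    rw [h, Finsupp.sum_zero_index] at this
    exact zero_ne_one this
  obtain ⟨u, hu⟩ := hne
  refine ⟨u, fun g hg => ?_⟩
  change φ (g ^ 2) u = u
  rw [pow_two, _root_.map_mul, RelIso.mul_apply]
  exact Realisation.apply_apply_eq_of_map_eq hg hu

theorem theoremA {G : Type*} [Group G] :
    -- actions on simplicial trees by graph automorphisms
    (∀ {V : Type*} (Γ : SimpleGraph V) (hΓ : Γ.IsTree) (φ : G →* (Γ ≃g Γ)),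
      HasStabilisation ((Realisation.autHom Γ hΓ.connected).comp φ) →
      (∀ v : V, PowerAlternative (vertexStabiliser φ v)) →
      (∀ ξ : TreeBoundary (Realisation Γ hΓ.connected),
        PowerAlternative
          (boundaryStabiliser ((Realisation.autHom Γ hΓ.connected).comp φ) ξ)) →
      PowerAlternative G) ∧
    -- isometric actions on real trees
    (∀ {T : Type*} [MetricSpace T] [Nonempty T], IsRealTree T → ∀ ρ : G →* (T ≃ᵢ T),
      HasStabilisation ρ →
      (∀ x : T, PowerAlternative (pointStabiliser ρ x)) →
      (∀ ξ : TreeBoundary T, PowerAlternative (boundaryStabiliser ρ ξ)) →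
      PowerAlternative G) ∧
    -- two elements have powers that generate a free group or fix a common point of `T ∪ ∂T`
    (∀ {T : Type*} [MetricSpace T] [Nonempty T], IsRealTree T → ∀ ρ : G →* (T ≃ᵢ T),
      HasStabilisation ρ →
      ∀ g h : G, ∃ n : ℕ, 1 ≤ n ∧
        (Nonempty (Subgroup.closure ({g ^ n, h ^ n} : Set G) ≃* FreeGroup (Fin 2)) ∨
          (∃ x : T, g ^ n ∈ pointStabiliser ρ x ∧ h ^ n ∈ pointStabiliser ρ x) ∨
          (∃ ξ : TreeBoundary T,
            g ^ n ∈ boundaryStabiliser ρ ξ ∧ h ^ n ∈ boundaryStabiliser ρ ξ))) := by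
  refine ⟨fun {V} Γ hΓ φ hstab hvert hbdry => ?_, fun {T} _ _ hT ρ hstab hpt hbdry => ?_,
    fun {T} _ _ hT ρ hstab g h => hT.isGeodesicZeroHyperbolic.hasFreeOrFixingPowers hstab g h⟩
  · have : Nonempty (Realisation Γ hΓ.connected) :=
      hΓ.connected.nonempty.map Realisation.vertex
    refine powerAlternative_of_forall_pow fun g h => ?_
    obtain ⟨n, hn, hfree | ⟨x, hg, hh⟩ | ⟨ξ, hg, hh⟩⟩ :=
      (Realisation.isGeodesicZeroHyperbolic hΓ).hasFreeOrFixingPowers hstab g h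
    · exact ⟨n, hn, Or.inl hfree⟩
    · obtain ⟨v, hv⟩ := Realisation.exists_sq_mem_vertexStabiliser φ x
      refine ⟨n * 2, by omega, Or.inr ⟨_, hvert v, ?_, ?_⟩⟩
      · rw [pow_mul]; exact hv _ hg
      · rw [pow_mul]; exact hv _ hh
    · exact ⟨n, hn, Or.inr ⟨_, hbdry ξ, hg, hh⟩⟩
  · refine powerAlternative_of_forall_pow fun g h => ?_
    obtain ⟨n, hn, hfree | ⟨x, hg, hh⟩ | ⟨ξ, hg, hh⟩⟩ :=
      hT.isGeodesicZeroHyperbolic.hasFreeOrFixingPowers hstab g h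
    · exact ⟨n, hn, Or.inl hfree⟩
    · exact ⟨n, hn, Or.inr ⟨_, hpt x, hg, hh⟩⟩
    · exact ⟨n, hn, Or.inr ⟨_, hbdry ξ, hg, hh⟩⟩
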